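/- **Spectrum on the imaginary axis for third-order equations.** Let $T>0$ and let $\mathbf A(x,\lambda)$, $x\in\mathbb R$, $\lambda\in\mathbb C$, be a complex $3\times3$ matrix, jointly continuous in $(x,\lambda)$, entire in $\lambda$, with $\mathbf A(x+T,\lambda)=\mathbf A(x,\lambda)$ and $\operatorname{tr}\mathbf A(x,\lambda)=0$ for all $x,\lambda$. Assume generalized Hamiltonian symmetry: (A1) $\mathbf A(x,\lambda)$ is real for $\lambda\in\mathbb R$; (A2) $\mathbf A^\top(x,\lambda)\mathbf B(\lambda)=-\mathbf B(\lambda)\mathbf A(x,-\lambda)$ for all $x,\lambda$, for some matrix $\mathbf B(\lambda)$ independent of $x$ and nonsingular except for at most finitely many $\lambda$. Let $\mathbf M(\lambda)=\mathbf V(T,\lambda)$ be the monodromy matrix, where $\mathbf V_x=\mathbf A\mathbf V$, $\mathbf V(0,\lambda)=\mathbf I$. The $L^2(\mathbb R)$ essential spectrum of $\mathbf v_x=\mathbf A(x,\lambda)\mathbf v$ is the set of $\lambda$ for which $\frac{d}{dx}-\mathbf A(\cdot,\lambda):H^1(\mathbb R;\mathbb C^3)\to L^2(\mathbb R;\mathbb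 C^3)$ is not Fredholm. The algebraic multiplicity of such a $\lambda$ is the dimension of the space spanned by the solutions $\mathbf v$ on $\mathbb R$ with $(S-\mu)^k\mathbf v=0$ for some $k\ge 1$ and some $|\mu|=1$, where $(S\mathbf v)(x)=\mathbf v(x+T)$. Fix $\lambda\in i\mathbb R$. Then $\mathbf M(\lambda)$ has either one or three eigenvalues on the unit circle, counted with algebraic multiplicity. Let $f=f_1+if_2=\operatorname{tr}\mathbf M(\lambda)$ and $$\Delta_3=|f|^4-4f^3-4\bar f^3+18|f|^2-27=(f_1^2+f_2^2)^2-8(f_1^3-3f_1f_2^2)+18(f_1^2+f_2^2)-27 .$$ * $\Delta_3<0$ if and only if $\mathbf M(\lambda)$ has three distinct eigenvalues on the unit circle. In that case $\lambda$ belongs to the $L^2(\mathbb R)$ essential spectrum with algebraic multiplicity three. * $\Delta_3>0$ if and only if $\mathbf M(\lambda)$ has one eigenvalue on the unit circle, one inside it and one outside it. The latter two then have the same argument and are reflections of each other through the circle ($\mu_3=1/\overline{\mu_2}$). * $\Delta_3=0$ if and only if all three eigenvalues of $\mathbf M(\lambda)$, counted with algebraic multiplicity, lie on the unit circle and at least two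 of them coincide. Let $\Gamma=\{2e^{i\theta}+e^{-2i\theta}:\theta\in[-\pi,\pi]\}$ be the deltoid curve. The first of these three configurations occurs if and only if $f$ lies inside $\Gamma$ (in the connected component of $\mathbb C\setminus\Gamma$ containing $0$), the second if and only if $f$ lies outside $\Gamma$ (in the unbounded component), and the third if and only if $f\in\Gamma$. If $f\in\Gamma$ is none of the cusps $3$, $3e^{2\pi i/3}$, $3e^{4\pi i/3}$, then one eigenvalue has algebraic multiplicity two and another has multiplicity one. If $f$ is one of these cusps, then, respectively, $1$, $e^{2\pi i/3}$, $e^{4\pi i/3}$ is an eigenvalue of algebraic multiplicity three. -/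

import Mathlib

open MeasureTheory
open scoped ENNReal ComplexConjugate

noncomputable section

/-- Generalized Hamiltonian symmetry of the coefficient matrix `A x l` of the first-order system
`v_x = A(x, l) v`, where `l` is the spectral parameter. -/
structure HasGeneralizedHamiltonianSymmetry {n : ℕ}
    (A : ℝ → ℂ → Matrix (Fin n) (Fin n) ℂ) : Prop where
  /-- (A1): `A(x, l)` is a real matrix whenever `l` is real. -/
  real_of_real : ∀ (x l : ℝ) (i j : Fin n), (A x (l : ℂ) i j).im = 0
  /-- (A2): `A(x, l)ᵀ B(l) = - B(l) A(x, -l)` for some `B(l)` which does not depend on `x` and is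
  nonsingular except for at most finitely many `l`. -/
  exists_skew : ∃ B : ℂ → Matrix (Fin n) (Fin n) ℂ,
    {l : ℂ | (B l).det = 0}.Finite ∧
      ∀ (x : ℝ) (l : ℂ), (A x l).transpose * B l = -(B l * A x (-l))

/-- `V` is the fundamental matrix of `v' = a v` on the real line normalized at `0`: `V' = a V`
(entrywise) and `V 0 = 1`. -/
def IsPrincipalFundamentalMatrix {n : ℕ} (a V : ℝ → Matrix (Fin n) (Fin n) ℂ) : Prop :=
  V 0 = 1 ∧ ∀ (x : ℝ) (i j : Fin n), HasDerivAt (fun y => V y i j) ((a x * V x) i j) x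

open Classical in
/-- The monodromy matrix `V(T)` of `v' = a v`. The second branch is never used for continuous `a`,
because `V` then exists (and is unique). -/
def monodromyMatrix {n : ℕ} (a : ℝ → Matrix (Fin n) (Fin n) ℂ) (T : ℝ) :
    Matrix (Fin n) (Fin n) ℂ :=
  if h : ∃ V, IsPrincipalFundamentalMatrix a V then h.choose T else 0

open Classical in
/-- The number of eigenvalues of `M` on the unit circle, counted with algebraic multiplicity. -/
def unitCircleEigenvalueCount {n : ℕ} (M : Matrix (Fin n) (Fin n) ℂ) : ℕ :=
  M.charpoly.roots.countP (fun μ => ‖μ‖ = 1)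

/-! ### The essential spectrum on `L²(ℝ)` -/

/-- The space `L²(ℝ; ℂⁿ)`. -/
abbrev L2Space (n : ℕ) : Type := Lp (EuclideanSpace ℂ (Fin n)) 2 (volume : Measure ℝ)

/-- The Sobolev space `H¹(ℝ; ℂⁿ)`, as the space of pairs `(u, w)` of `L²` functions such that `w` is
the distributional derivative of `u`, with the norm of `L² × L²`. -/
def H1Space (n : ℕ) : Submodule ℂ (L2Space n × L2Space n) :=
  (((TemperedDistribution.derivCLM (EuclideanSpace ℂ (Fin n))) ∘L
        (Lp.toTemperedDistributionCLM (EuclideanSpace ℂ (Fin n)) (volume : Measure ℝ) 2) ∘L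
        ContinuousLinearMap.fst ℂ (L2Space n) (L2Space n)) -
      (Lp.toTemperedDistributionCLM (EuclideanSpace ℂ (Fin n)) (volume : Measure ℝ) 2) ∘L
        ContinuousLinearMap.snd ℂ (L2Space n) (L2Space n)).ker

open Classical in
/-- The operator of multiplication by an (essentially) bounded matrix function on `L²(ℝ; ℂⁿ)`;
it is set to `0` if `a` is not essentially bounded. -/
def matrixMulL2 {n : ℕ} (a : ℝ → Matrix (Fin n) (Fin n) ℂ) : L2Space n →L[ℂ] L2Space n :=
  if h : MemLp (fun x => Matrix.toEuclideanCLM (n := Fin n) (𝕜 := ℂ) (a x)) ∞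
      (volume : Measure ℝ) then
    (ContinuousLinearMap.id ℂ (EuclideanSpace ℂ (Fin n) →L[ℂ] EuclideanSpace ℂ (Fin n))).holderL
      volume ∞ 2 2 (h.toLp _)
  else 0

/-- For essentially bounded `a`, the operator `matrixMulL2 a` sends `u` to `x ↦ a(x) u(x)`. -/
theorem coeFn_matrixMulL2 {n : ℕ} {a : ℝ → Matrix (Fin n) (Fin n) ℂ}
    (h : MemLp (fun x => Matrix.toEuclideanCLM (n := Fin n) (𝕜 := ℂ) (a x)) ∞
      (volume : Measure ℝ)) (u : L2Space n) :
    ∀ᵐ x, matrixMulL2 a u x = Matrix.toEuclideanCLM (n := Fin n) (𝕜 := ℂ) (a x) (u x) := by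
  rw [matrixMulL2, dif_pos h]
  filter_upwards [ContinuousLinearMap.coeFn_holder (r := 2)
    (ContinuousLinearMap.id ℂ (EuclideanSpace ℂ (Fin n) →L[ℂ] EuclideanSpace ℂ (Fin n)))
    (h.toLp _) u, h.coeFn_toLp] with x hx hx'
  rw [ContinuousLinearMap.holderL_apply_apply, hx, hx']
  rfl

/-- The operator `d/dx - a(x)` from `H¹(ℝ; ℂⁿ)` to `L²(ℝ; ℂⁿ)`. -/
def firstOrderOperator {n : ℕ} (a : ℝ → Matrix (Fin n) (Fin n) ℂ) :
    H1Space n →L[ℂ] L2Space n :=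
  (ContinuousLinearMap.snd ℂ (L2Space n) (L2Space n) -
      matrixMulL2 a ∘L ContinuousLinearMap.fst ℂ (L2Space n) (L2Space n)) ∘L
    (H1Space n).subtypeL

/-- The `L²(ℝ)` essential spectrum of the spectral problem `v_x = A(x, l) v`: the set of all `l` for
which `d/dx - A(·, l) : H¹ → L²` is not a Fredholm operator. -/
def essentialSpectrumL2 {n : ℕ} (A : ℝ → ℂ → Matrix (Fin n) (Fin n) ℂ) : Set ℂ :=
  {l | ¬ (firstOrderOperator (fun x => A x l)).IsFredholm}

/-- The space of all (classical) solutions on the real line of `v' = a v`. -/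
def solutionSpace {n : ℕ} (a : ℝ → Matrix (Fin n) (Fin n) ℂ) : Submodule ℂ (ℝ → Fin n → ℂ) where
  carrier := {v | ∀ (x : ℝ) (i : Fin n), HasDerivAt (fun y => v y i) ((a x).mulVec (v x) i) x}
  zero_mem' := by
    intro x i
    simpa using hasDerivAt_const x (0 : ℂ)
  add_mem' := by
    intro v w hv hw x i
    simpa [Matrix.mulVec_add] using (hv x i).fun_add (hw x i)
  smul_mem' := by
    intro c v hv x i
    simpa [Matrix.mulVec_smul] using (hv x i).const_mul c

/-- Translation by the period, `v ↦ v(· + T)`. -/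
def translation (n : ℕ) (T : ℝ) : Module.End ℂ (ℝ → Fin n → ℂ) :=
  LinearMap.funLeft ℂ (Fin n → ℂ) (fun x => x + T)

/-- The space of generalized Bloch solutions of `v' = a v` with Floquet multiplier `μ`: the solutions
`v` that are annihilated by some power of `v ↦ v(· + T) - μ v`. -/
def generalizedBlochSpace {n : ℕ} (a : ℝ → Matrix (Fin n) (Fin n) ℂ) (T : ℝ) (μ : ℂ) :
    Submodule ℂ (ℝ → Fin n → ℂ) :=
  solutionSpace a ⊓ (translation n T).maxGenEigenspace μ

/-- The algebraic multiplicity of `l` in the `L²(ℝ)` essential spectrum of `v_x = A(x, l) v`, with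
`A` of period `T` in `x`: the dimension of the space spanned by the generalized Bloch solutions
whose Floquet multiplier lies on the unit circle. -/
def essentialSpectrumMultiplicity {n : ℕ} (A : ℝ → ℂ → Matrix (Fin n) (Fin n) ℂ) (T : ℝ) (l : ℂ) :
    ℕ :=
  Module.finrank ℂ
    (⨆ μ ∈ {μ : ℂ | ‖μ‖ = 1}, generalizedBlochSpace (fun x => A x l) T μ :
      Submodule ℂ (ℝ → Fin n → ℂ))

/-! ### The discriminant and the deltoid -/

/-- The discriminant `Δ₃` as a real polynomial in `f₁ = Re f` and `f₂ = Im f`. -/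
def delta3 (f : ℂ) : ℝ :=
  (f.re ^ 2 + f.im ^ 2) ^ 2 - 8 * (f.re ^ 3 - 3 * f.re * f.im ^ 2)
    + 18 * (f.re ^ 2 + f.im ^ 2) - 27

/-- The deltoid curve. -/
def deltoid : Set ℂ :=
  {z | ∃ θ ∈ Set.Icc (-Real.pi) Real.pi,
    z = 2 * Complex.exp (θ * Complex.I) + Complex.exp (-2 * θ * Complex.I)}

/-- The region inside the deltoid: the connected component of its complement containing `0`. -/
def deltoidInside : Set ℂ := connectedComponentIn deltoidᶜ 0

/-- The region outside the deltoid: the unbounded connected component of its complement. -/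
def deltoidOutside : Set ℂ :=
  {z | z ∉ deltoid ∧ ¬ Bornology.IsBounded (connectedComponentIn deltoidᶜ z)}

/-! ### Configurations of the three eigenvalues of a `3 × 3` matrix -/

/-- Three distinct eigenvalues, all on the unit circle. -/
def ThreeDistinctOnCircle (M : Matrix (Fin 3) (Fin 3) ℂ) : Prop :=
  ∃ μ₁ μ₂ μ₃ : ℂ, M.charpoly.roots = {μ₁, μ₂, μ₃} ∧ μ₁ ≠ μ₂ ∧ μ₁ ≠ μ₃ ∧ μ₂ ≠ μ₃ ∧
    ‖μ₁‖ = 1 ∧ ‖μ₂‖ = 1 ∧ ‖μ₃‖ = 1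

/-- One eigenvalue on the unit circle, one inside and one outside; the latter two have the same
argument and are reflections of each other through the unit circle. -/
def OneOnCircleTwoReflected (M : Matrix (Fin 3) (Fin 3) ℂ) : Prop :=
  ∃ μ₁ μ₂ μ₃ : ℂ, M.charpoly.roots = {μ₁, μ₂, μ₃} ∧ ‖μ₁‖ = 1 ∧ ‖μ₂‖ < 1 ∧ 1 < ‖μ₃‖ ∧
    μ₂ ≠ 0 ∧ μ₃.arg = μ₂.arg ∧ μ₃ = (conj μ₂)⁻¹

/-- All three eigenvalues on the unit circle, counted with algebraic multiplicity, and at least two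
of them coincide. -/
def DegenerateOnCircle (M : Matrix (Fin 3) (Fin 3) ℂ) : Prop :=
  ∃ μ ν : ℂ, M.charpoly.roots = {μ, μ, ν} ∧ ‖μ‖ = 1 ∧ ‖ν‖ = 1

end

/-! For imaginary `l` the symmetries fix the shape of the characteristic polynomial of `M`.
Differentiating `(V l x)ᵀ * B l * V (-l) x` and using (A2) shows that it is constant in `x`, so `V l
x` has the same trace as the inverse of `V (-l) x`. By (A1) and Schwarz reflection, `V (conj l)` is
the entrywise conjugate of `V l`. On the imaginary axis `-l = conj l`, and Liouville's formula gives
determinant one. Hence the eigenvalues have elementary symmetric functions `f`, `conj f`, `1`.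

Such a cubic is self-inversive: its roots are permuted by `z ↦ 1 / conj z`, so either all three lie
on the unit circle or one does and the other two are mirror images. Its discriminant is `delta3 f`,
the square of `(a - b) * (b - c) * (c - a)`. That product is purely imaginary in the first case and
real and nonzero in the second, which gives the sign criterion.

The deltoid is the zero set of `delta3`, since a double root `μ` forces the third to be `μ⁻²`.
Monotonicity of `delta3` along rays from the origin (`delta3_le_delta3_mul`) then matches the two
signs with the inside and the outside.

For the spectrum, an eigenvector for an eigenvalue on the circle produces a Bloch solution of
periodic norm. Cutting it off on far-apart intervals gives orthonormal functions whose images tend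
to zero, which no Fredholm operator allows. Three distinct eigenvalues on the circle give an
eigenbasis, so the Bloch solutions span the full solution space. -/

/-! ### Self-inversive cubics: triples of complex numbers with `a b c = 1` and
`a b + b c + c a = conj (a + b + c)` -/

/-- The elementary symmetric functions of `a, b, c` are `f, conj f, 1`. -/
structure IsSelfInversiveTriple (f a b c : ℂ) : Prop where
  sum_eq : a + b + c = f
  pair_eq : a * b + b * c + c * a = conj f
  prod_eq : a * b * c = 1

namespace IsSelfInversiveTriple

variable {f a b c : ℂ}

lemma rotate (h : IsSelfInversiveTriple f a b c) : IsSelfInversiveTriple f b c a :=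
  ⟨by rw [← h.sum_eq]; ring, by rw [← h.pair_eq]; ring, by rw [← h.prod_eq]; ring⟩

lemma swap (h : IsSelfInversiveTriple f a b c) : IsSelfInversiveTriple f a c b :=
  ⟨by rw [← h.sum_eq]; ring, by rw [← h.pair_eq]; ring, by rw [← h.prod_eq]; ring⟩

lemma ne_zero (h : IsSelfInversiveTriple f a b c) : a ≠ 0 := by
  rintro rfl
  simpa using h.prod_eq

/-- Conjugating the cubic equation `a³ - f a² + conj f a - 1 = 0` and dividing by `(conj a)³`
returns the same cubic at `1 / conj a`, which is therefore one of its roots. -/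
lemma conj_inv_eq (h : IsSelfInversiveTriple f a b c) :
    (conj a)⁻¹ = a ∨ (conj a)⁻¹ = b ∨ (conj a)⁻¹ = c := by
  have ha : conj a ≠ 0 := by simpa using h.ne_zero
  have h1 : a ^ 3 - f * a ^ 2 + conj f * a - 1 = 0 := by
    rw [← h.pair_eq, ← h.sum_eq, ← h.prod_eq]; ring
  have h2 := congrArg conj h1
  simp only [map_sub, map_add, map_mul, map_pow, map_one, map_zero, Complex.conj_conj] at h2
  have h3 : ((conj a)⁻¹ - a) * ((conj a)⁻¹ - b) * ((conj a)⁻¹ - c) = 0 := by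
    have : ((conj a)⁻¹ - a) * ((conj a)⁻¹ - b) * ((conj a)⁻¹ - c) =
        (conj a)⁻¹ ^ 3 - (a + b + c) * (conj a)⁻¹ ^ 2 +
          (a * b + b * c + c * a) * (conj a)⁻¹ - a * b * c := by ring
    rw [this, h.sum_eq, h.pair_eq, h.prod_eq]
    field_simp
    linear_combination -h2
  rcases mul_eq_zero.mp h3 with h3 | h3
  · rcases mul_eq_zero.mp h3 with h3 | h3
    · exact Or.inl (sub_eq_zero.mp h3)
    · exact Or.inr (Or.inl (sub_eq_zero.mp h3))
  · exact Or.inr (Or.inr (sub_eq_zero.mp h3))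

/-- Reflection gives `‖a‖ * ‖b‖ = 1`, so `a * b * c = 1` puts the remaining root on the circle; the
pair is ordered according to which member is inside. -/
lemma reflected_of_conj_inv_eq (h : IsSelfInversiveTriple f a b c) (hb : (conj a)⁻¹ = b)
    (ha : ‖a‖ ≠ 1) :
    ∃ μ₁ μ₂ μ₃ : ℂ, ({a, b, c} : Multiset ℂ) = {μ₁, μ₂, μ₃} ∧ ‖μ₁‖ = 1 ∧ ‖μ₂‖ < 1 ∧ 1 < ‖μ₃‖ ∧
      μ₂ ≠ 0 ∧ μ₃ = (conj μ₂)⁻¹ := by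
  have ha0 := h.ne_zero
  have hpos : 0 < ‖a‖ := norm_pos_iff.mpr ha0
  have hnb : ‖b‖ = ‖a‖⁻¹ := by rw [← hb]; simp
  have hc : ‖c‖ = 1 := by
    have := congrArg norm h.prod_eq
    rw [norm_mul, norm_mul, hnb, norm_one] at this
    field_simp at this
    exact this
  rcases lt_or_gt_of_ne ha with hlt | hgt
  · refine ⟨c, a, b, ?_, hc, hlt, ?_, ha0, hb.symm⟩
    · simp only [Multiset.insert_eq_cons, ← Multiset.singleton_add]; abel
    · rw [hnb]; exact (one_lt_inv₀ hpos).mpr hlt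
  · refine ⟨c, b, a, ?_, hc, ?_, hgt, h.rotate.ne_zero, ?_⟩
    · simp only [Multiset.insert_eq_cons, ← Multiset.singleton_add]; abel
    · rw [hnb]; exact inv_lt_one_of_one_lt₀ hgt
    · rw [← hb]; simp

lemma eq_conj_inv_of_norm_eq_one {z : ℂ} (hz : ‖z‖ = 1) : conj z = z⁻¹ := by
  rw [Complex.inv_eq_conj hz]

lemma norm_eq_one_of_conj_inv_eq {z : ℂ} (hz : z ≠ 0) (h : (conj z)⁻¹ = z) : ‖z‖ = 1 := by
  have h1 := congrArg norm h
  have hpos : 0 < ‖z‖ := norm_pos_iff.mpr hz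
  rw [norm_inv, RCLike.norm_conj] at h1
  have h2 : ‖z‖ * ‖z‖ = 1 := by
    nth_rewrite 1 [← h1]
    exact inv_mul_cancel₀ hpos.ne'
  nlinarith

/-- If not all three numbers lie on the unit circle, then one does and the two others are
reflections of each other. -/
lemma norm_eq_one_or_reflected (h : IsSelfInversiveTriple f a b c) :
    (‖a‖ = 1 ∧ ‖b‖ = 1 ∧ ‖c‖ = 1) ∨
    ∃ μ₁ μ₂ μ₃ : ℂ, ({a, b, c} : Multiset ℂ) = {μ₁, μ₂, μ₃} ∧ ‖μ₁‖ = 1 ∧ ‖μ₂‖ < 1 ∧ 1 < ‖μ₃‖ ∧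
      μ₂ ≠ 0 ∧ μ₃ = (conj μ₂)⁻¹ := by
  have key : ∀ {a b c : ℂ}, IsSelfInversiveTriple f a b c → ‖a‖ = 1 ∨
      ∃ μ₁ μ₂ μ₃ : ℂ, ({a, b, c} : Multiset ℂ) = {μ₁, μ₂, μ₃} ∧ ‖μ₁‖ = 1 ∧ ‖μ₂‖ < 1 ∧
        1 < ‖μ₃‖ ∧ μ₂ ≠ 0 ∧ μ₃ = (conj μ₂)⁻¹ := by
    intro a b c h
    by_cases ha : ‖a‖ = 1
    · exact Or.inl ha
    refine Or.inr ?_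
    rcases h.conj_inv_eq with h1 | h1 | h1
    · exact absurd (norm_eq_one_of_conj_inv_eq h.ne_zero h1) ha
    · exact h.reflected_of_conj_inv_eq h1 ha
    · have hm : ({a, b, c} : Multiset ℂ) = {a, c, b} := by
        simp only [Multiset.insert_eq_cons, ← Multiset.singleton_add]; abel
      rw [hm]
      exact h.swap.reflected_of_conj_inv_eq h1 ha
  have hm1 : ({a, b, c} : Multiset ℂ) = {b, c, a} := by
    simp only [Multiset.insert_eq_cons, ← Multiset.singleton_add]; abel
  have hm2 : ({a, b, c} : Multiset ℂ) = {c, a, b} := by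
    simp only [Multiset.insert_eq_cons, ← Multiset.singleton_add]; abel
  rcases key h with ha | ha
  · rcases key h.rotate with hb | hb
    · rcases key h.rotate.rotate with hc | hc
      · exact Or.inl ⟨ha, hb, hc⟩
      · rw [← hm2] at hc; exact Or.inr hc
    · rw [← hm1] at hb; exact Or.inr hb
  · exact Or.inr ha

lemma ofReal_delta3 (f : ℂ) : (delta3 f : ℂ) =
    (f * conj f) ^ 2 - 4 * f ^ 3 - 4 * (conj f) ^ 3 + 18 * (f * conj f) - 27 := by
  apply Complex.ext <;>
    simp [delta3, pow_succ, Complex.add_re, Complex.mul_re, Complex.mul_im] <;> ring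

lemma delta3_eq_sq (h : IsSelfInversiveTriple f a b c) :
    (delta3 f : ℂ) = ((a - b) * (b - c) * (c - a)) ^ 2 := by
  rw [ofReal_delta3, ← h.pair_eq, ← h.sum_eq]
  linear_combination (4 * (a + b + c) ^ 3 - 18 * (a + b + c) * (a * b + b * c + c * a) +
    27 * (a * b * c + 1)) * h.prod_eq

/-- On the circle conjugation is inversion, which together with `a * b * c = 1` negates the product
of differences. That product is thus purely imaginary, with square minus its squared modulus. -/
lemma delta3_of_norm_eq_one (h : IsSelfInversiveTriple f a b c) (ha : ‖a‖ = 1) (hb : ‖b‖ = 1)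
    (hc : ‖c‖ = 1) : delta3 f = -Complex.normSq ((a - b) * (b - c) * (c - a)) := by
  have h1 : conj ((a - b) * (b - c) * (c - a)) = -((a - b) * (b - c) * (c - a)) := by
    have ha0 := h.ne_zero
    have hb0 := h.rotate.ne_zero
    have hc0 := h.rotate.rotate.ne_zero
    simp only [map_mul, map_sub, eq_conj_inv_of_norm_eq_one ha, eq_conj_inv_of_norm_eq_one hb,
      eq_conj_inv_of_norm_eq_one hc]
    field_simp
    linear_combination ((a - b) * (b - c) * (c - a)) * (a * b * c + 1) * h.prod_eq
  have h2 := h.delta3_eq_sq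
  have : (delta3 f : ℂ) = ((-Complex.normSq ((a - b) * (b - c) * (c - a)) : ℝ) : ℂ) := by
    rw [h2, Complex.ofReal_neg, ← Complex.mul_conj, h1]; ring
  exact_mod_cast this

/-- Here conjugation inverts and also exchanges `b` and `c`. The exchange contributes a further
sign, so the product of differences is real; the three distinct moduli make it nonzero. -/
lemma delta3_pos_of_reflected (h : IsSelfInversiveTriple f a b c) (ha : ‖a‖ = 1) (hb : ‖b‖ < 1)
    (hc : 1 < ‖c‖) (hbc : c = (conj b)⁻¹) : 0 < delta3 f := by
  have hb1 : conj b = c⁻¹ := by rw [hbc, inv_inv]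
  have hc1 : conj c = b⁻¹ := by rw [hbc]; simp
  have h1 : conj ((a - b) * (b - c) * (c - a)) = (a - b) * (b - c) * (c - a) := by
    have ha0 := h.ne_zero
    have hb0 := h.rotate.ne_zero
    have hc0 := h.rotate.rotate.ne_zero
    simp only [map_mul, map_sub, eq_conj_inv_of_norm_eq_one ha, hb1, hc1]
    field_simp
    linear_combination -((a - b) * (b - c) * (c - a)) * (a * b * c + 1) * h.prod_eq
  have h2 := h.delta3_eq_sq
  have h3 : (delta3 f : ℂ) = ((Complex.normSq ((a - b) * (b - c) * (c - a)) : ℝ) : ℂ) := by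
    rw [h2, ← Complex.mul_conj, h1]; ring
  have h4 : delta3 f = Complex.normSq ((a - b) * (b - c) * (c - a)) := by exact_mod_cast h3
  rw [h4, Complex.normSq_pos]
  have hab : a - b ≠ 0 := by
    intro h0; rw [sub_eq_zero.mp h0] at ha; linarith
  have hbc' : b - c ≠ 0 := by
    intro h0; rw [sub_eq_zero.mp h0] at hb; linarith
  have hca : c - a ≠ 0 := by
    intro h0; rw [sub_eq_zero.mp h0] at hc; linarith
  exact mul_ne_zero (mul_ne_zero hab hbc') hca

/-- Lets the deltoid be studied for arbitrary `f`, with no matrix at hand. -/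
lemma exists_triple (f : ℂ) : ∃ a b c, IsSelfInversiveTriple f a b c := by
  obtain ⟨a, ha⟩ : ∃ a : ℂ, a ^ 3 - f * a ^ 2 + conj f * a - 1 = 0 := by
    have hdeg : (Cubic.toPoly ⟨1, -f, conj f, -1⟩ : Polynomial ℂ).degree ≠ 0 := by
      rw [Cubic.degree_of_a_ne_zero (by simp)]; decide
    obtain ⟨a, ha⟩ := IsAlgClosed.exists_root _ hdeg
    refine ⟨a, ?_⟩
    simp [Cubic.toPoly] at ha
    linear_combination ha
  have ha0 : a ≠ 0 := by
    rintro rfl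
    simp at ha
  obtain ⟨s, hs⟩ := IsAlgClosed.exists_pow_nat_eq ((f - a) ^ 2 - 4 * a⁻¹) (n := 2) (by norm_num)
  have hinv : a * a⁻¹ = 1 := mul_inv_cancel₀ ha0
  -- The quadratic formula for the two numbers with sum `f - a` and product `a⁻¹`.
  refine ⟨a, (f - a + s) / 2, (f - a - s) / 2, ?_, ?_, ?_⟩
  · ring
  · have : a * (a * (f - a) + a⁻¹ - conj f) = 0 := by
      linear_combination -ha + hinv
    have h0 := (mul_eq_zero.mp this).resolve_left ha0
    linear_combination h0 - hs / 4
  · linear_combination hinv - a * hs / 4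

/-- Three numbers on the circle with vanishing discriminant: two of them coincide. -/
lemma exists_double_of_delta3_eq_zero (h : IsSelfInversiveTriple f a b c) (hd : delta3 f = 0) :
    ∃ μ ν : ℂ, ({a, b, c} : Multiset ℂ) = {μ, μ, ν} ∧ ‖μ‖ = 1 ∧ ‖ν‖ = 1 ∧
      IsSelfInversiveTriple f μ μ ν := by
  rcases h.norm_eq_one_or_reflected with ⟨ha, hb, hc⟩ | ⟨μ₁, μ₂, μ₃, hm, h1, h2, h3, -, h5⟩
  · have h0 := h.delta3_eq_sq
    rw [hd, Complex.ofReal_zero, eq_comm, sq_eq_zero_iff, mul_eq_zero, mul_eq_zero, sub_eq_zero,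
      sub_eq_zero, sub_eq_zero] at h0
    rcases h0 with (h0 | h0) | h0
    · subst h0; exact ⟨a, c, rfl, ha, hc, h⟩
    · subst h0
      refine ⟨b, a, ?_, hb, ha, h.rotate⟩
      simp only [Multiset.insert_eq_cons, ← Multiset.singleton_add]; abel
    · subst h0
      refine ⟨c, b, ?_, hc, hb, h.rotate.rotate⟩
      simp only [Multiset.insert_eq_cons, ← Multiset.singleton_add]; abel
  · have hs := congrArg Multiset.sum hm
    have hp := congrArg Multiset.prod hm
    have hq := congrArg (fun s : Multiset ℂ => (s.map fun z => 1 - z).prod) hm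
    simp at hs hp hq
    have h' : IsSelfInversiveTriple f μ₁ μ₂ μ₃ := by
      refine ⟨?_, ?_, ?_⟩
      · rw [← h.sum_eq]; linear_combination -hs
      · rw [← h.pair_eq]; linear_combination -hs - hp - hq
      · rw [← h.prod_eq]; linear_combination -hp
    exact absurd hd (h'.delta3_pos_of_reflected h1 h2 h3 h5).ne'

end IsSelfInversiveTriple

/-! ### The deltoid and its complement -/

/-- The parametrization is the sum of the triple `z, z, z⁻²` with `z = exp (θ * I)`; conversely, a
vanishing discriminant yields such a triple, and `θ` is the argument of its double root. -/
lemma mem_deltoid_iff (f : ℂ) : f ∈ deltoid ↔ delta3 f = 0 := by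
  constructor
  · rintro ⟨θ, -, rfl⟩
    have hz : ‖Complex.exp (θ * Complex.I)‖ = 1 := Complex.norm_exp_ofReal_mul_I θ
    set z := Complex.exp (θ * Complex.I) with hzdef
    have hw : Complex.exp (-2 * θ * Complex.I) = z⁻¹ ^ 2 := by
      rw [hzdef, ← Complex.exp_neg, ← Complex.exp_nat_mul]; congr 1; push_cast; ring
    have hz0 : z ≠ 0 := Complex.exp_ne_zero _
    have h : IsSelfInversiveTriple (2 * z + z⁻¹ ^ 2) z z (z⁻¹ ^ 2) := by
      refine ⟨by ring, ?_, ?_⟩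
      · simp only [map_add, map_mul, map_pow, map_inv₀, map_ofNat,
          IsSelfInversiveTriple.eq_conj_inv_of_norm_eq_one hz]
        field_simp
        ring
      · field_simp
    have h2 := h.delta3_eq_sq
    rw [hw]
    simpa using h2
  · intro hd
    obtain ⟨a, b, c, h⟩ := IsSelfInversiveTriple.exists_triple f
    obtain ⟨μ, ν, -, hμ, hν, h'⟩ := h.exists_double_of_delta3_eq_zero hd
    refine ⟨μ.arg, ⟨(Complex.neg_pi_lt_arg μ).le, Complex.arg_le_pi μ⟩, ?_⟩
    have hz : Complex.exp (μ.arg * Complex.I) = μ := by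
      have := Complex.norm_mul_exp_arg_mul_I μ
      rwa [hμ, Complex.ofReal_one, one_mul] at this
    have hw : Complex.exp (-2 * μ.arg * Complex.I) = μ⁻¹ ^ 2 := by
      nth_rewrite 2 [← hz]
      rw [← Complex.exp_neg, ← Complex.exp_nat_mul]; congr 1; push_cast; ring
    rw [hz, hw, ← h'.sum_eq]
    have h0 := h'.ne_zero
    have h3 : ν = μ⁻¹ ^ 2 := by
      field_simp
      linear_combination h'.prod_eq
    rw [h3]; ring

/-- With `r2 = |f|²` and `k = Re f³`, the radial derivative is `4 x (x² r2² - 6 x k + 9 r2)`. The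
quadratic in `x` has discriminant `36 (k² - r2³) ≤ 0`, because `|Re f³| ≤ |f|³`. -/
lemma delta3_le_delta3_mul {f : ℂ} {s t : ℝ} (hs : 0 ≤ s) (hst : s ≤ t) :
    delta3 (s * f) ≤ delta3 (t * f) := by
  have hd : ∀ x : ℝ, HasDerivAt (fun t : ℝ => delta3 (t * f))
      (4 * x ^ 3 * (f.re ^ 2 + f.im ^ 2) ^ 2 - 24 * x ^ 2 * (f.re ^ 3 - 3 * f.re * f.im ^ 2)
        + 36 * x * (f.re ^ 2 + f.im ^ 2)) x := by
    intro x
    have he : (fun t : ℝ => delta3 (t * f)) = fun t : ℝ => t ^ 4 * (f.re ^ 2 + f.im ^ 2) ^ 2 -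
        t ^ 3 * (8 * (f.re ^ 3 - 3 * f.re * f.im ^ 2)) + t ^ 2 * (18 * (f.re ^ 2 + f.im ^ 2))
          - 27 := by
      ext t; simp [delta3]; ring
    rw [he]
    convert! ((((hasDerivAt_pow 4 x).mul_const ((f.re ^ 2 + f.im ^ 2) ^ 2)).sub
      ((hasDerivAt_pow 3 x).mul_const (8 * (f.re ^ 3 - 3 * f.re * f.im ^ 2)))).add
      ((hasDerivAt_pow 2 x).mul_const (18 * (f.re ^ 2 + f.im ^ 2)))).sub_const 27 using 1
    push_cast; ring
  have hmono : MonotoneOn (fun t : ℝ => delta3 (t * f)) (Set.Ici 0) := by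
    apply monotoneOn_of_deriv_nonneg (convex_Ici 0)
    · exact fun x _ => (hd x).continuousAt.continuousWithinAt
    · exact fun x _ => (hd x).differentiableAt.differentiableWithinAt
    · intro x hx
      rw [interior_Ici, Set.mem_Ioi] at hx
      rw [(hd x).deriv]
      set r2 := f.re ^ 2 + f.im ^ 2 with hr2
      set k := f.re ^ 3 - 3 * f.re * f.im ^ 2 with hk
      have hk2 : k ^ 2 ≤ r2 ^ 3 := by
        -- The gap `r2³ - k²` is exactly `(Im f³)²`.
        rw [hk, hr2]; nlinarith [sq_nonneg (3 * f.re ^ 2 * f.im - f.im ^ 3)]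
      have hr0 : 0 ≤ r2 := by positivity
      rcases hr0.eq_or_lt with h0 | h0
      · have : k = 0 := by
          rw [← h0] at hk2
          nlinarith [sq_nonneg k]
        rw [this, ← h0]; simp
      · have : 0 ≤ r2 * (x ^ 2 * r2 ^ 2 - 6 * x * k + 9 * r2) := by
          nlinarith [sq_nonneg (x * r2 ^ 2 - 3 * k), sq_nonneg (x * r2 ^ 2)]
        have h2 := nonneg_of_mul_nonneg_right this h0
        nlinarith [mul_nonneg hx.le h2]
  exact hmono hs (hs.trans hst) hst

lemma continuous_delta3 : Continuous delta3 := by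
  unfold delta3; fun_prop

/-- Since `Re f³ ≤ r³` for `r = ‖f‖`, `delta3 f` is at least `r⁴ - 8 r³ + 18 r² - 27 = (r - 3)³ (r +
1)`. -/
lemma norm_lt_three_of_delta3_neg {f : ℂ} (h : delta3 f < 0) : ‖f‖ < 3 := by
  by_contra! h3
  have hr2 : ‖f‖ ^ 2 = f.re ^ 2 + f.im ^ 2 := by
    rw [Complex.sq_norm, Complex.normSq_apply]; ring
  set r := ‖f‖
  have hk2 : (f.re ^ 3 - 3 * f.re * f.im ^ 2) ^ 2 ≤ (r ^ 3) ^ 2 := by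
    have : (r ^ 3) ^ 2 = (r ^ 2) ^ 3 := by ring
    rw [this, hr2]; nlinarith [sq_nonneg (3 * f.re ^ 2 * f.im - f.im ^ 3)]
  have hk : f.re ^ 3 - 3 * f.re * f.im ^ 2 ≤ r ^ 3 := by
    exact le_of_abs_le (abs_le_of_sq_le_sq hk2 (by positivity))
  unfold delta3 at h
  rw [← hr2] at h
  have : 0 ≤ (r - 3) ^ 3 * (r + 1) := by
    have : 0 ≤ r - 3 := by linarith
    positivity
  nlinarith

/-- By the intermediate value theorem `delta3` keeps its sign on a component of the complement.
Conversely, radial monotonicity keeps the segment from `0` to `f` in the negative region. -/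
lemma mem_deltoidInside_iff (f : ℂ) : f ∈ deltoidInside ↔ delta3 f < 0 := by
  have h0 : delta3 0 < 0 := by simp [delta3]
  have hc : ∀ z : ℂ, z ∈ deltoidᶜ ↔ delta3 z ≠ 0 := fun z => by
    rw [Set.mem_compl_iff, mem_deltoid_iff]
  constructor
  · intro hf
    by_contra! hge
    have hpre : IsPreconnected deltoidInside := isPreconnected_connectedComponentIn
    have h0m : (0 : ℂ) ∈ deltoidInside := mem_connectedComponentIn ((hc 0).mpr h0.ne)
    obtain ⟨z, hz, hz0⟩ := hpre.intermediate_value h0m hf continuous_delta3.continuousOn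
      ⟨h0.le, hge⟩
    exact (hc z).mp (connectedComponentIn_subset _ _ hz) hz0
  · intro hf
    have hseg : IsPreconnected ((fun t : ℝ => (t : ℂ) * f) '' Set.Icc 0 1) :=
      isPreconnected_Icc.image _ (by fun_prop)
    refine hseg.subset_connectedComponentIn (x := 0) ⟨0, by simp, by simp⟩ ?_ ⟨1, by simp, by simp⟩
    rintro _ ⟨t, ht, rfl⟩
    rw [hc]
    have := delta3_le_delta3_mul (f := f) ht.1 ht.2
    rw [Complex.ofReal_one, one_mul] at this
    exact (this.trans_lt hf).ne

/-- A component on which `delta3` is negative lies in the disc of radius `3`. Where `delta3 f` is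
positive, the whole ray outward from `f` avoids the deltoid, so the component is unbounded. -/
lemma mem_deltoidOutside_iff (f : ℂ) : f ∈ deltoidOutside ↔ 0 < delta3 f := by
  have hc : ∀ z : ℂ, z ∈ deltoidᶜ ↔ delta3 z ≠ 0 := fun z => by
    rw [Set.mem_compl_iff, mem_deltoid_iff]
  constructor
  · rintro ⟨hf, hunb⟩
    by_contra! hle
    have hlt : delta3 f < 0 := lt_of_le_of_ne hle ((hc f).mp hf)
    apply hunb
    refine (Metric.isBounded_ball (x := (0 : ℂ)) (r := 3)).subset ?_
    intro z hz
    rw [mem_ball_zero_iff]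
    apply norm_lt_three_of_delta3_neg
    by_contra! hge
    obtain ⟨w, hw, hw0⟩ := isPreconnected_connectedComponentIn.intermediate_value
      (mem_connectedComponentIn hf) hz continuous_delta3.continuousOn ⟨hlt.le, hge⟩
    exact (hc w).mp (connectedComponentIn_subset _ _ hw) hw0
  · intro hf
    refine ⟨(hc f).mpr hf.ne', fun hb => ?_⟩
    have hray : IsPreconnected ((fun t : ℝ => (t : ℂ) * f) '' Set.Ici 1) :=
      isPreconnected_Ici.image _ (by fun_prop)
    have hsub : (fun t : ℝ => (t : ℂ) * f) '' Set.Ici 1 ⊆ connectedComponentIn deltoidᶜ f := by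
      refine hray.subset_connectedComponentIn ⟨1, by simp, by simp⟩ ?_
      rintro _ ⟨t, ht, rfl⟩
      rw [hc]
      have := delta3_le_delta3_mul (f := f) zero_le_one (Set.mem_Ici.mp ht)
      rw [Complex.ofReal_one, one_mul] at this
      exact (hf.trans_le this).ne'
    obtain ⟨R, hR⟩ := (hb.subset hsub).exists_norm_le
    have hf0 : f ≠ 0 := by
      rintro rfl
      norm_num [delta3] at hf
    have hpos : 0 < ‖f‖ := norm_pos_iff.mpr hf0
    have ht : 1 ≤ |R| / ‖f‖ + 1 := by
      have : 0 ≤ |R| / ‖f‖ := by positivity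
      linarith
    have := hR _ ⟨|R| / ‖f‖ + 1, ht, rfl⟩
    rw [norm_mul, Complex.norm_real, Real.norm_of_nonneg (by linarith), add_mul,
      div_mul_cancel₀ _ hpos.ne'] at this
    linarith [le_abs_self R]

/-! ### Eigenvalues of a `3 × 3` matrix with self-inversive characteristic polynomial -/

/-- The sum of the principal `2 × 2` minors. -/
lemma trace_adjugate_fin_three (M : Matrix (Fin 3) (Fin 3) ℂ) :
    M.adjugate.trace = M 0 0 * M 1 1 - M 0 1 * M 1 0 + (M 0 0 * M 2 2 - M 0 2 * M 2 0) +
      (M 1 1 * M 2 2 - M 1 2 * M 2 1) := by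
  rw [Matrix.trace_fin_three, Matrix.adjugate_fin_three]
  simp
  ring

lemma exists_charpoly_roots_fin_three (M : Matrix (Fin 3) (Fin 3) ℂ) :
    ∃ a b c : ℂ, M.charpoly.roots = {a, b, c} := by
  have hcard : M.charpoly.roots.card = 3 := by
    rw [Polynomial.splits_iff_card_roots.mp (IsAlgClosed.splits M.charpoly),
      Matrix.charpoly_natDegree_eq_dim, Fintype.card_fin]
  exact Multiset.card_eq_three.mp hcard

/-- The characteristic polynomial at `1` is one minus the trace plus the second symmetric function
minus the determinant; this isolates the second one, which equals the trace of the adjugate. -/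
lemma isSelfInversiveTriple_of_charpoly_roots {M : Matrix (Fin 3) (Fin 3) ℂ} (hdet : M.det = 1)
    (hadj : M.adjugate.trace = conj M.trace) {a b c : ℂ} (h : M.charpoly.roots = {a, b, c}) :
    IsSelfInversiveTriple M.trace a b c := by
  have hs : M.trace = a + b + c := by
    rw [Matrix.trace_eq_sum_roots_charpoly, h]; simp; ring
  have hp : a * b * c = 1 := by
    rw [← hdet, Matrix.det_eq_prod_roots_charpoly, h]; simp; ring
  have hq : M.charpoly.eval 1 = (1 - a) * (1 - b) * (1 - c) := by
    have hsplit := (IsAlgClosed.splits M.charpoly).eq_prod_roots_of_monic M.charpoly_monic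
    rw [h] at hsplit
    rw [hsplit]
    simp
    ring
  rw [Matrix.eval_charpoly, Matrix.det_fin_three] at hq
  simp at hq
  rw [trace_adjugate_fin_three] at hadj
  rw [Matrix.det_fin_three] at hdet
  refine ⟨hs.symm, ?_, hp⟩
  rw [Matrix.trace_fin_three] at hs hadj
  rw [Matrix.trace_fin_three, ← hadj]
  linear_combination -hq - hs - hdet + hp

open Classical in
lemma unitCircleEigenvalueCount_eq {M : Matrix (Fin 3) (Fin 3) ℂ} {a b c : ℂ}
    (h : M.charpoly.roots = {a, b, c}) : unitCircleEigenvalueCount M =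
      (if ‖a‖ = 1 then 1 else 0) + (if ‖b‖ = 1 then 1 else 0) + (if ‖c‖ = 1 then 1 else 0) := by
  unfold unitCircleEigenvalueCount
  rw [h]
  simp only [Multiset.insert_eq_cons, ← Multiset.cons_zero, Multiset.countP_cons,
    Multiset.countP_zero]
  ring

section Classification

variable {M : Matrix (Fin 3) (Fin 3) ℂ} (hdet : M.det = 1)
  (hadj : M.adjugate.trace = conj M.trace)
include hdet hadj

lemma ThreeDistinctOnCircle.delta3_neg (h : ThreeDistinctOnCircle M) : delta3 M.trace < 0 := by
  obtain ⟨a, b, c, hr, hab, hac, hbc, ha, hb, hc⟩ := h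
  rw [(isSelfInversiveTriple_of_charpoly_roots hdet hadj hr).delta3_of_norm_eq_one ha hb hc,
    neg_lt_zero, Complex.normSq_pos]
  exact mul_ne_zero (mul_ne_zero (sub_ne_zero.mpr hab) (sub_ne_zero.mpr hbc))
    (sub_ne_zero.mpr hac.symm)

lemma OneOnCircleTwoReflected.delta3_pos (h : OneOnCircleTwoReflected M) :
    0 < delta3 M.trace := by
  obtain ⟨a, b, c, hr, ha, hb, hc, -, -, hbc⟩ := h
  exact (isSelfInversiveTriple_of_charpoly_roots hdet hadj hr).delta3_pos_of_reflected ha hb hc hbc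

lemma DegenerateOnCircle.delta3_eq_zero (h : DegenerateOnCircle M) : delta3 M.trace = 0 := by
  obtain ⟨a, b, hr, -, -⟩ := h
  have := (isSelfInversiveTriple_of_charpoly_roots hdet hadj hr).delta3_eq_sq
  simpa using this

lemma threeDistinct_or_reflected_or_degenerate :
    ThreeDistinctOnCircle M ∨ OneOnCircleTwoReflected M ∨ DegenerateOnCircle M := by
  obtain ⟨a, b, c, hr⟩ := exists_charpoly_roots_fin_three M
  have h := isSelfInversiveTriple_of_charpoly_roots hdet hadj hr
  by_cases hd : delta3 M.trace = 0
  · obtain ⟨μ, ν, hm, hμ, hν, -⟩ := h.exists_double_of_delta3_eq_zero hd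
    exact Or.inr (Or.inr ⟨μ, ν, hr.trans hm, hμ, hν⟩)
  rcases h.norm_eq_one_or_reflected with ⟨ha, hb, hc⟩ | ⟨μ₁, μ₂, μ₃, hm, h1, h2, h3, h4, h5⟩
  · left
    have hsq := h.delta3_eq_sq
    refine ⟨a, b, c, hr, ?_, ?_, ?_, ha, hb, hc⟩ <;> rintro rfl <;> apply hd <;> simpa using hsq
  · refine Or.inr (Or.inl ⟨μ₁, μ₂, μ₃, hr.trans hm, h1, h2, h3, h4, ?_, h5⟩)
    have h6 : μ₃ = ((Complex.normSq μ₂)⁻¹ : ℝ) * μ₂ := by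
      rw [h5, Complex.inv_def, Complex.conj_conj, Complex.normSq_conj, mul_comm]
    rw [h6, Complex.arg_real_mul _ (inv_pos.mpr (Complex.normSq_pos.mpr h4))]

lemma threeDistinctOnCircle_iff : ThreeDistinctOnCircle M ↔ delta3 M.trace < 0 := by
  refine ⟨fun h => h.delta3_neg hdet hadj, fun h => ?_⟩
  rcases threeDistinct_or_reflected_or_degenerate hdet hadj with h1 | h1 | h1
  · exact h1
  · exact absurd (h1.delta3_pos hdet hadj) h.not_gt
  · exact absurd (h1.delta3_eq_zero hdet hadj) h.ne

lemma oneOnCircleTwoReflected_iff : OneOnCircleTwoReflected M ↔ 0 < delta3 M.trace := by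
  refine ⟨fun h => h.delta3_pos hdet hadj, fun h => ?_⟩
  rcases threeDistinct_or_reflected_or_degenerate hdet hadj with h1 | h1 | h1
  · exact absurd (h1.delta3_neg hdet hadj) h.not_gt
  · exact h1
  · exact absurd (h1.delta3_eq_zero hdet hadj) h.ne'

lemma degenerateOnCircle_iff : DegenerateOnCircle M ↔ delta3 M.trace = 0 := by
  refine ⟨fun h => h.delta3_eq_zero hdet hadj, fun h => ?_⟩
  rcases threeDistinct_or_reflected_or_degenerate hdet hadj with h1 | h1 | h1
  · exact absurd h (h1.delta3_neg hdet hadj).ne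
  · exact absurd h (h1.delta3_pos hdet hadj).ne'
  · exact h1

lemma unitCircleEigenvalueCount_eq_one_or_three :
    unitCircleEigenvalueCount M = 1 ∨ unitCircleEigenvalueCount M = 3 := by
  rcases threeDistinct_or_reflected_or_degenerate hdet hadj with
    ⟨a, b, c, hr, -, -, -, ha, hb, hc⟩ | ⟨a, b, c, hr, ha, hb, hc, -⟩ | ⟨a, b, hr, ha, hb⟩
  · right; rw [unitCircleEigenvalueCount_eq hr]; simp [ha, hb, hc]
  · left; rw [unitCircleEigenvalueCount_eq hr]; simp [ha, hb.ne, hc.ne']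
  · right; rw [unitCircleEigenvalueCount_eq hr]; simp [ha, hb]

/-- At a cusp `3 ω`, `ω ^ 3 = 1`, of the deltoid, `ω` is a triple eigenvalue. -/
lemma charpoly_roots_of_trace_eq_three_mul {ω : ℂ} (hω : ω ^ 3 = 1) (ht : M.trace = 3 * ω) :
    M.charpoly.roots = {ω, ω, ω} := by
  obtain ⟨a, b, c, hr⟩ := exists_charpoly_roots_fin_three M
  have h := isSelfInversiveTriple_of_charpoly_roots hdet hadj hr
  have hn : ‖ω‖ = 1 := by
    have := congrArg norm hω
    rw [norm_pow, norm_one] at this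
    exact (pow_eq_one_iff_of_nonneg (norm_nonneg _) (by norm_num)).mp this
  have hω0 : ω ≠ 0 := by rintro rfl; simp at hn
  have hc : conj ω = ω ^ 2 := by
    rw [IsSelfInversiveTriple.eq_conj_inv_of_norm_eq_one hn]
    field_simp
    exact hω.symm
  rw [ht] at h
  have key : ∀ {a b c : ℂ}, IsSelfInversiveTriple (3 * ω) a b c → a = ω := by
    intro a b c h
    have h2 := h.pair_eq
    rw [map_mul, hc, map_ofNat] at h2
    have : (a - ω) ^ 3 = 0 := by
      -- The cubic for `f = 3 ω` is `z³ - 3 ω z² + 3 ω² z - 1 = (z - ω)³`.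
      linear_combination a ^ 2 * h.sum_eq - a * h2 + h.prod_eq - hω
    exact sub_eq_zero.mp (pow_eq_zero_iff (by norm_num) |>.mp this)
  rw [hr, key h, key h.rotate, key h.rotate.rotate]

/-- Away from the three cusps of the deltoid there is a double and a simple eigenvalue. -/
lemma exists_charpoly_roots_double (hd : delta3 M.trace = 0)
    (hcusp : ∀ ω : ℂ, ω ^ 3 = 1 → M.trace ≠ 3 * ω) :
    ∃ μ ν : ℂ, μ ≠ ν ∧ ‖μ‖ = 1 ∧ ‖ν‖ = 1 ∧ M.charpoly.roots = {μ, μ, ν} := by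
  obtain ⟨μ, ν, hr, hμ, hν⟩ := (degenerateOnCircle_iff hdet hadj).mpr hd
  refine ⟨μ, ν, ?_, hμ, hν, hr⟩
  rintro rfl
  have h := isSelfInversiveTriple_of_charpoly_roots hdet hadj hr
  refine hcusp μ ?_ ?_
  · rw [← h.prod_eq]; ring
  · rw [← h.sum_eq]; ring

end Classification

/-! ### Cube roots of unity and the cusps of the deltoid -/

lemma exp_two_pi_div_three_pow : Complex.exp (2 * Real.pi * Complex.I / 3) ^ 3 = 1 := by
  rw [← Complex.exp_nat_mul, Complex.exp_eq_one_iff]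
  exact ⟨1, by push_cast; ring⟩

lemma exp_four_pi_div_three_eq : Complex.exp (4 * Real.pi * Complex.I / 3) =
    Complex.exp (2 * Real.pi * Complex.I / 3) ^ 2 := by
  rw [← Complex.exp_nat_mul]; congr 1; push_cast; ring

lemma exp_two_pi_div_three_ne_one : Complex.exp (2 * Real.pi * Complex.I / 3) ≠ 1 := by
  have := (Complex.isPrimitiveRoot_exp 3 (by norm_num)).ne_one (by norm_num)
  simpa using this

lemma eq_of_pow_three_eq_one {z : ℂ} (hz : z ^ 3 = 1) :
    z = 1 ∨ z = Complex.exp (2 * Real.pi * Complex.I / 3) ∨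
      z = Complex.exp (4 * Real.pi * Complex.I / 3) := by
  rw [exp_four_pi_div_three_eq]
  have h3 := exp_two_pi_div_three_pow
  have h1 := exp_two_pi_div_three_ne_one
  set ω := Complex.exp (2 * Real.pi * Complex.I / 3)
  have hs : ω ^ 2 + ω + 1 = 0 := by
    have : (ω - 1) * (ω ^ 2 + ω + 1) = 0 := by linear_combination h3
    exact (mul_eq_zero.mp this).resolve_left (sub_ne_zero.mpr h1)
  have : (z - 1) * ((z - ω) * (z - ω ^ 2)) = 0 := by
    linear_combination hz - (z - 1) * z * hs + (z - 1) * h3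
  rcases mul_eq_zero.mp this with h | h
  · exact Or.inl (sub_eq_zero.mp h)
  rcases mul_eq_zero.mp h with h | h
  · exact Or.inr (Or.inl (sub_eq_zero.mp h))
  · exact Or.inr (Or.inr (sub_eq_zero.mp h))

/-! ### Linear differential equations with a parameter -/

section Dyson

variable {E P : Type*} [NormedAddCommGroup E] [NormedSpace ℝ E]

/-- The terms of the Dyson series of the initial value problem `u' = a u`, `u 0 = w`. -/
noncomputable def dysonTerm (a : ℝ → P → E →L[ℝ] E) (w : E) : ℕ → P → ℝ → E
  | 0 => fun _ _ => w
  | k + 1 => fun p x => ∫ t in (0 : ℝ)..x, a t p (dysonTerm a w k p t)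

lemma continuous_dysonTerm [TopologicalSpace P] {a : ℝ → P → E →L[ℝ] E}
    (ha : Continuous fun q : ℝ × P => a q.1 q.2) (w : E) (k : ℕ) :
    Continuous fun q : P × ℝ => dysonTerm a w k q.1 q.2 := by
  induction k with
  | zero => exact continuous_const
  | succ k ih =>
    refine intervalIntegral.continuous_parametric_intervalIntegral_of_continuous
      (f := fun (q : P × ℝ) t => a t q.1 (dysonTerm a w k q.1 t)) ?_ continuous_snd
    exact (ha.comp (f := fun r : (P × ℝ) × ℝ => (r.2, r.1.1)) (by fun_prop)).clm_apply
      (ih.comp (f := fun r : (P × ℝ) × ℝ => (r.1.1, r.2)) (by fun_prop))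

/-- Each integration raises the power of `|x|` and supplies the next factor of the factorial, so the
Dyson series is dominated by an exponential series. -/
lemma norm_dysonTerm_le {a : ℝ → P → E →L[ℝ] E} {p : P} {K R : ℝ} (hK : 0 ≤ K)
    (hbd : ∀ t, |t| ≤ R → ‖a t p‖ ≤ K) (w : E) (k : ℕ) {x : ℝ} (hx : |x| ≤ R) :
    ‖dysonTerm a w k p x‖ ≤ ‖w‖ * ((K * |x|) ^ k / k.factorial) := by
  induction k generalizing x with
  | zero => simp [dysonTerm]
  | succ k ih =>
    have hint : IntegrableOn (fun t : ℝ => K * (‖w‖ * ((K * |t - 0|) ^ k / k.factorial)))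
        (Set.uIoc 0 x) := by
      refine (Continuous.integrableOn_Icc (a := min 0 x) (b := max 0 x) (by fun_prop)).mono_set ?_
      exact Set.Ioc_subset_Icc_self
    calc ‖dysonTerm a w (k + 1) p x‖
        = ‖∫ t in Set.uIoc 0 x, a t p (dysonTerm a w k p t)‖ := by
          rw [dysonTerm, intervalIntegral.norm_integral_eq_norm_integral_uIoc]
      _ ≤ ∫ t in Set.uIoc 0 x, K * (‖w‖ * ((K * |t - 0|) ^ k / k.factorial)) := by
          refine norm_integral_le_of_norm_le hint ?_
          refine (ae_restrict_iff' measurableSet_uIoc).mpr (Filter.Eventually.of_forall ?_)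
          intro t ht
          have htR : |t| ≤ R := by
            have := Set.abs_sub_left_of_mem_uIcc (Set.uIoc_subset_uIcc ht)
            simp only [sub_zero] at this
            linarith
          rw [sub_zero]
          exact (ContinuousLinearMap.le_opNorm _ _).trans
            (mul_le_mul (hbd t htR) (ih htR) (norm_nonneg _) hK)
      _ = ‖w‖ * ((K * |x|) ^ (k + 1) / (k + 1).factorial) := by
          have : ∀ t : ℝ, K * (‖w‖ * ((K * |t - 0|) ^ k / k.factorial)) =
              ‖w‖ * K ^ (k + 1) / k.factorial * |t - 0| ^ k := by
            intro t; rw [mul_pow]; ring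
          simp_rw [this]
          rw [integral_const_mul, integral_pow_abs_sub_uIoc, sub_zero, Nat.factorial_succ, mul_pow]
          push_cast
          field_simp

variable [TopologicalSpace P] {a : ℝ → P → E →L[ℝ] E}
  (ha : Continuous fun q : ℝ × P => a q.1 q.2)
include ha

lemma exists_norm_le_of_isCompact {N : Set P} (hN : IsCompact N) (R : ℝ) :
    ∃ K, 0 ≤ K ∧ ∀ p ∈ N, ∀ t, |t| ≤ R → ‖a t p‖ ≤ K := by
  obtain ⟨K, hK⟩ := (((isCompact_Icc (a := -R) (b := R)).prod hN).image ha).isBounded.exists_norm_le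
  exact ⟨|K|, abs_nonneg K, fun p hp t ht =>
    (hK _ ⟨(t, p), ⟨abs_le.mp ht, hp⟩, rfl⟩).trans (le_abs_self K)⟩

variable [CompleteSpace E] (w : E)

/-- The sum of the Dyson series solves the initial value problem. -/
lemma hasDerivAt_tsum_dysonTerm (p : P) (x : ℝ) :
    HasDerivAt (fun y => w + ∑' k, dysonTerm a w (k + 1) p y)
      (a x p (w + ∑' k, dysonTerm a w (k + 1) p x)) x := by
  obtain ⟨K, hK, hbd⟩ := exists_norm_le_of_isCompact ha (isCompact_singleton (x := p)) (|x| + 1)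
  have hbd' := hbd p rfl
  have hx : x ∈ Set.Ioo (-(|x| + 1)) (|x| + 1) := by
    rw [Set.mem_Ioo, ← abs_lt]; linarith
  have hsum := (Real.summable_pow_div_factorial (K * (|x| + 1))).mul_left ‖w‖
  have hle : ∀ (k : ℕ) (y : ℝ), |y| ≤ |x| + 1 →
      ‖dysonTerm a w k p y‖ ≤ ‖w‖ * ((K * (|x| + 1)) ^ k / k.factorial) := by
    intro k y hy
    refine (norm_dysonTerm_le hK hbd' w k hy).trans ?_
    gcongr
  have hs : Summable fun k => dysonTerm a w k p x :=
    Summable.of_norm_bounded hsum fun k => hle k x (by linarith)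
  -- Term `k + 1` differentiates to `a` applied to term `k`; splitting off the constant term `w`
  -- makes the index shift match.
  have h1 : a x p (w + ∑' k, dysonTerm a w (k + 1) p x) =
      ∑' k, a x p (dysonTerm a w k p x) := by
    rw [← (a x p).map_tsum hs, hs.tsum_eq_zero_add]
    rfl
  rw [h1]
  refine HasDerivAt.const_add w ?_
  refine hasDerivAt_tsum_of_isPreconnected (hsum.mul_left K) isOpen_Ioo isPreconnected_Ioo
    (g := fun k y => dysonTerm a w (k + 1) p y) (g' := fun k y => a y p (dysonTerm a w k p y))
    ?_ ?_ hx ?_ hx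
  · intro k y _
    have hc : Continuous fun t => a t p (dysonTerm a w k p t) :=
      (ha.comp (f := fun t : ℝ => (t, p)) (by fun_prop)).clm_apply
        ((continuous_dysonTerm ha w k).comp (f := fun t : ℝ => (p, t)) (by fun_prop))
    exact intervalIntegral.integral_hasDerivAt_right (hc.intervalIntegrable _ _)
      (hc.stronglyMeasurableAtFilter _ _) hc.continuousAt
  · intro k y hy
    have hy' : |y| ≤ |x| + 1 := (abs_lt.mpr hy).le
    exact (ContinuousLinearMap.le_opNorm _ _).trans
      (mul_le_mul (hbd' y hy') (hle k y hy') (norm_nonneg _) hK)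
  · exact (summable_nat_add_iff 1).mpr hs

/-- The sum of the Dyson series depends continuously on the parameter. -/
lemma continuous_tsum_dysonTerm [LocallyCompactSpace P] (x : ℝ) :
    Continuous fun p => w + ∑' k, dysonTerm a w (k + 1) p x := by
  refine continuous_const.add (continuous_iff_continuousAt.mpr fun p => ?_)
  obtain ⟨N, hN, hpN⟩ := exists_compact_mem_nhds p
  obtain ⟨K, hK, hbd⟩ := exists_norm_le_of_isCompact ha hN |x|
  refine ContinuousOn.continuousAt (s := N) ?_ hpN
  refine continuousOn_tsum (u := fun k => ‖w‖ * ((K * |x|) ^ (k + 1) / (k + 1).factorial)) ?_ ?_ ?_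
  · exact fun k => ((continuous_dysonTerm ha w (k + 1)).comp
      (f := fun p : P => (p, x)) (by fun_prop)).continuousOn
  · exact (summable_nat_add_iff 1).mpr
      ((Real.summable_pow_div_factorial (K * |x|)).mul_left ‖w‖)
  · exact fun k q hq => norm_dysonTerm_le hK (hbd q hq) w (k + 1) le_rfl

end Dyson

/-! ### Fundamental matrices -/

section Fundamental

variable {n : ℕ}

/-- The real-linear operator on `ℂⁿ` given by a matrix. -/
noncomputable def mulVecCLM (A : Matrix (Fin n) (Fin n) ℂ) : (Fin n → ℂ) →L[ℝ] (Fin n → ℂ) :=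
  (LinearMap.toContinuousLinearMap (Matrix.toLin' A)).restrictScalars ℝ

@[simp]
lemma mulVecCLM_apply (A : Matrix (Fin n) (Fin n) ℂ) (v : Fin n → ℂ) :
    mulVecCLM A v = A.mulVec v := by
  simp [mulVecCLM]

lemma continuous_mulVecCLM : Continuous (mulVecCLM (n := n)) := by
  refine continuous_clm_apply.mpr fun v => ?_
  simp only [mulVecCLM_apply]
  fun_prop

lemma mem_solutionSpace_iff {a : ℝ → Matrix (Fin n) (Fin n) ℂ} {v : ℝ → Fin n → ℂ} :
    v ∈ solutionSpace a ↔ ∀ x, HasDerivAt v ((a x).mulVec (v x)) x := by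
  simp only [hasDerivAt_pi]
  rfl

/-- Solutions of a continuous linear system are determined by their value at `0`. -/
lemma eq_of_mem_solutionSpace {a : ℝ → Matrix (Fin n) (Fin n) ℂ} (ha : Continuous a)
    {v w : ℝ → Fin n → ℂ} (hv : v ∈ solutionSpace a) (hw : w ∈ solutionSpace a)
    (h0 : v 0 = w 0) : v = w := by
  rw [mem_solutionSpace_iff] at hv hw
  have hc : Continuous fun q : ℝ × Unit => mulVecCLM (a q.1) :=
    continuous_mulVecCLM.comp (ha.comp continuous_fst)
  ext1 x
  -- The one-point parameter space `Unit` specializes the parametric bound to a single equation.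
  obtain ⟨K, hK, hbd⟩ := exists_norm_le_of_isCompact (a := fun t (_ : Unit) => mulVecCLM (a t)) hc
    (isCompact_singleton (x := ())) (|x| + 1)
  have hx : x ∈ Set.Ioo (-(|x| + 1)) (|x| + 1) := by
    rw [Set.mem_Ioo, ← abs_lt]; linarith
  have h0' : (0 : ℝ) ∈ Set.Ioo (-(|x| + 1)) (|x| + 1) := by
    rw [Set.mem_Ioo, ← abs_lt, abs_zero]; positivity
  refine ODE_solution_unique_of_mem_Ioo (v := fun t u => mulVecCLM (a t) u) (K := K.toNNReal)
    (s := fun _ => Set.univ) ?_ h0' ?_ ?_ h0 hx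
  · intro t ht
    refine LipschitzWith.lipschitzOnWith ?_
    refine (mulVecCLM (a t)).lipschitz.weaken ?_
    rw [← NNReal.coe_le_coe, Real.coe_toNNReal K hK]
    exact hbd () rfl t (abs_lt.mpr ht).le
  · exact fun t _ => ⟨by simpa using hv t, Set.mem_univ _⟩
  · exact fun t _ => ⟨by simpa using hw t, Set.mem_univ _⟩

lemma IsPrincipalFundamentalMatrix.mulVec_mem {a V : ℝ → Matrix (Fin n) (Fin n) ℂ}
    (hV : IsPrincipalFundamentalMatrix a V) (w : Fin n → ℂ) :
    (fun x => (V x).mulVec w) ∈ solutionSpace a := by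
  intro x i
  have : ∀ y, (V y).mulVec w i = ∑ j, V y i j * w j := fun y => rfl
  simp only [this]
  rw [Matrix.mulVec_mulVec]
  exact HasDerivAt.fun_sum fun j _ => (hV.2 x i j).mul_const (w j)

lemma IsPrincipalFundamentalMatrix.eq_mulVec {a V : ℝ → Matrix (Fin n) (Fin n) ℂ}
    (ha : Continuous a) (hV : IsPrincipalFundamentalMatrix a V) {v : ℝ → Fin n → ℂ}
    (hv : v ∈ solutionSpace a) : v = fun x => (V x).mulVec (v 0) :=
  eq_of_mem_solutionSpace ha hv (hV.mulVec_mem _) (by simp [hV.1])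

lemma IsPrincipalFundamentalMatrix.unique {a V W : ℝ → Matrix (Fin n) (Fin n) ℂ}
    (ha : Continuous a) (hV : IsPrincipalFundamentalMatrix a V)
    (hW : IsPrincipalFundamentalMatrix a W) : V = W := by
  ext x i j
  have := congrFun (congrFun (hV.eq_mulVec ha (hW.mulVec_mem (Pi.single j 1))) x) i
  beta_reduce at this
  rw [hW.1, Matrix.one_mulVec, Matrix.mulVec_single_one, Matrix.mulVec_single_one] at this
  exact this.symm

lemma IsPrincipalFundamentalMatrix.monodromyMatrix_eq {a V : ℝ → Matrix (Fin n) (Fin n) ℂ}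
    (ha : Continuous a) (hV : IsPrincipalFundamentalMatrix a V) (T : ℝ) :
    monodromyMatrix a T = V T := by
  have h : ∃ V, IsPrincipalFundamentalMatrix a V := ⟨V, hV⟩
  rw [monodromyMatrix, dif_pos h, h.choose_spec.unique ha hV]

/-- Fundamental matrices exist and depend continuously on parameters. -/
lemma exists_isPrincipalFundamentalMatrix {P : Type*} [TopologicalSpace P] [LocallyCompactSpace P]
    {A : ℝ → P → Matrix (Fin n) (Fin n) ℂ} (hA : Continuous fun q : ℝ × P => A q.1 q.2) :
    ∃ V : P → ℝ → Matrix (Fin n) (Fin n) ℂ,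
      (∀ p, IsPrincipalFundamentalMatrix (fun x => A x p) (V p)) ∧
        ∀ x, Continuous fun p => V p x := by
  have hc : Continuous fun q : ℝ × P => mulVecCLM (A q.1 q.2) := continuous_mulVecCLM.comp hA
  let u : Fin n → P → ℝ → Fin n → ℂ := fun j p x => Pi.single j 1 +
    ∑' k, dysonTerm (fun t p => mulVecCLM (A t p)) (Pi.single j 1) (k + 1) p x
  refine ⟨fun p x => Matrix.of fun i j => u j p x i, fun p => ⟨?_, ?_⟩, fun x => ?_⟩
  · ext i j
    simp [u, dysonTerm, Matrix.one_apply, Pi.single_apply]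
  · intro x i j
    have h := hasDerivAt_pi.mp (hasDerivAt_tsum_dysonTerm
      (a := fun t p => mulVecCLM (A t p)) hc (Pi.single j 1) p x) i
    rw [mulVecCLM_apply] at h
    exact h
  · refine continuous_matrix fun i j => ?_
    exact (continuous_apply i).comp (continuous_tsum_dysonTerm
      (a := fun t p => mulVecCLM (A t p)) hc (Pi.single j 1) x)

end Fundamental

/-! ### Consequences of the Hamiltonian symmetry for the monodromy matrix -/

/-- Schwarz reflection for entire functions that are real on the real axis. -/
lemma apply_conj_of_im_eq_zero {g : ℂ → ℂ} (hg : Differentiable ℂ g)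
    (hreal : ∀ x : ℝ, (g x).im = 0) (z : ℂ) : g (conj z) = conj (g z) := by
  have hh : Differentiable ℂ (conj ∘ g ∘ conj) := fun z => by
    rw [differentiableAt_conj_conj_iff]; exact hg _
  have ha : AnalyticOnNhd ℂ g Set.univ := hg.differentiableOn.analyticOnNhd isOpen_univ
  have hb : AnalyticOnNhd ℂ (conj ∘ g ∘ conj) Set.univ :=
    hh.differentiableOn.analyticOnNhd isOpen_univ
  have heq : ∀ x : ℝ, g x = (conj ∘ g ∘ conj) x := fun x => by
    simp only [Function.comp_apply, Complex.conj_ofReal]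
    exact (Complex.conj_eq_iff_im.mpr (hreal x)).symm
  -- The two entire functions agree on the real line, which accumulates at `0`, so the identity
  -- theorem applies.
  have hfreq : ∃ᶠ z in nhdsWithin (0 : ℂ) {0}ᶜ, g z = (conj ∘ g ∘ conj) z := by
    have ht : Filter.Tendsto (fun x : ℝ => (x : ℂ)) (nhdsWithin 0 {0}ᶜ) (nhdsWithin 0 {0}ᶜ) := by
      refine tendsto_nhdsWithin_of_tendsto_nhds_of_eventually_within _ ?_ ?_
      · have := Complex.continuous_ofReal.tendsto (0 : ℝ)
        rw [Complex.ofReal_zero] at this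
        exact this.mono_left nhdsWithin_le_nhds
      · filter_upwards [self_mem_nhdsWithin] with x hx
        simpa using hx
    exact ht.frequently (Filter.Frequently.of_forall heq)
  have := congrFun (ha.eq_of_frequently_eq hb hfreq) (conj z)
  rw [this]
  simp

section Fundamental

variable {n : ℕ}

lemma IsPrincipalFundamentalMatrix.map_conj {a V : ℝ → Matrix (Fin n) (Fin n) ℂ}
    (hV : IsPrincipalFundamentalMatrix a V) :
    IsPrincipalFundamentalMatrix (fun x => (a x).map conj) (fun x => (V x).map conj) := by
  refine ⟨?_, fun x i j => ?_⟩
  · ext i j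
    simp [hV.1, Matrix.one_apply, apply_ite]
  · have := (hV.2 x i j).star
    rw [← Matrix.map_mul]
    exact this

/-- The bilinear first integral attached to a skew symmetry. -/
lemma IsPrincipalFundamentalMatrix.transpose_mul_mul_eq {a b V W : ℝ → Matrix (Fin n) (Fin n) ℂ}
    (hV : IsPrincipalFundamentalMatrix a V) (hW : IsPrincipalFundamentalMatrix b W)
    {B : Matrix (Fin n) (Fin n) ℂ} (hB : ∀ x, (a x).transpose * B = -(B * b x)) (x : ℝ) :
    (V x).transpose * B * W x = B := by
  have hd : ∀ (i j : Fin n) (y : ℝ),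
      HasDerivAt (fun y => ((V y).transpose * B * W y) i j) 0 y := by
    intro i j y
    have hsum : ∀ y, ((V y).transpose * B * W y) i j = ∑ k, (∑ m, V y m i * B m k) * W y k j :=
      fun y => rfl
    simp only [hsum]
    have h1 : HasDerivAt (fun y => ∑ k, (∑ m, V y m i * B m k) * W y k j)
        (∑ k, ((∑ m, (a y * V y) m i * B m k) * W y k j +
          (∑ m, V y m i * B m k) * (b y * W y) k j)) y :=
      HasDerivAt.fun_sum fun k _ =>
        (HasDerivAt.fun_sum fun m _ => (hV.2 y m i).mul_const _).fun_mul (hW.2 y k j)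
    convert! h1 using 1
    have h2 : (((a y * V y).transpose * B * W y) + ((V y).transpose * B * (b y * W y))) i j =
        ∑ k, ((∑ m, (a y * V y) m i * B m k) * W y k j +
          (∑ m, V y m i * B m k) * (b y * W y) k j) := by
      rw [Finset.sum_add_distrib]; rfl
    have h3 : ((a y * V y).transpose * B * W y) + ((V y).transpose * B * (b y * W y)) = 0 := by
      rw [Matrix.transpose_mul, Matrix.mul_assoc (V y).transpose, hB]
      simp only [Matrix.mul_assoc, Matrix.mul_neg, Matrix.neg_mul]
      simp
    rw [← h2, h3]; rfl
  ext i j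
  have := is_const_of_deriv_eq_zero (fun y => (hd i j y).differentiableAt)
    (fun y => (hd i j y).deriv) x 0
  simpa [hV.1, hW.1] using this

/-- Liouville's formula for trace-free `3 × 3` systems. -/
lemma IsPrincipalFundamentalMatrix.det_eq_one {a V : ℝ → Matrix (Fin 3) (Fin 3) ℂ}
    (hV : IsPrincipalFundamentalMatrix a V) (ha : ∀ x, (a x).trace = 0) (x : ℝ) :
    (V x).det = 1 := by
  have hd : ∀ y, HasDerivAt (fun y => (V y).det) 0 y := by
    intro y
    simp only [Matrix.det_fin_three]
    have h := hV.2 y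
    have := ((((((h 0 0).fun_mul (h 1 1)).fun_mul (h 2 2)).fun_sub
      (((h 0 0).fun_mul (h 1 2)).fun_mul (h 2 1))).fun_sub
      (((h 0 1).fun_mul (h 1 0)).fun_mul (h 2 2))).fun_add
      (((h 0 1).fun_mul (h 1 2)).fun_mul (h 2 0))).fun_add
      (((h 0 2).fun_mul (h 1 0)).fun_mul (h 2 1)) |>.fun_sub
      (((h 0 2).fun_mul (h 1 1)).fun_mul (h 2 0))
    convert! this using 1
    have ht := ha y
    rw [Matrix.trace_fin_three] at ht
    simp only [Matrix.mul_apply, Fin.sum_univ_three]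
    linear_combination -(V y).det * ht + (a y 0 0 + a y 1 1 + a y 2 2) * Matrix.det_fin_three (V y)
  have := is_const_of_deriv_eq_zero (fun y => (hd y).differentiableAt) (fun y => (hd y).deriv) x 0
  rw [this, hV.1, Matrix.det_one]

end Fundamental

/-- The relation makes `Mᵀ` similar, through `B`, to the inverse of `N`, which is its adjugate as
`N.det = 1`. -/
lemma trace_eq_trace_adjugate_of_transpose_mul_mul_eq {n : ℕ} {M N B : Matrix (Fin n) (Fin n) ℂ}
    (hB : B.det ≠ 0) (hN : N.det = 1) (h : M.transpose * B * N = B) :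
    M.trace = N.adjugate.trace := by
  have hu : IsUnit B.det := hB.isUnit
  have h1 : M.transpose * B = B * N.adjugate := by
    calc M.transpose * B = M.transpose * B * (N * N.adjugate) := by
          rw [Matrix.mul_adjugate, hN, one_smul, Matrix.mul_one]
      _ = B * N.adjugate := by rw [← Matrix.mul_assoc, h]
  have h2 : M.transpose = B * N.adjugate * B⁻¹ := by
    rw [← h1, Matrix.mul_nonsing_inv_cancel_right _ _ hu]
  rw [← Matrix.trace_transpose, h2, Matrix.trace_mul_comm, ← Matrix.mul_assoc,
    Matrix.nonsing_inv_mul _ hu, Matrix.one_mul]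

section Monodromy

variable {A : ℝ → ℂ → Matrix (Fin 3) (Fin 3) ℂ} {V : ℂ → ℝ → Matrix (Fin 3) (Fin 3) ℂ}
  (hV : ∀ l, IsPrincipalFundamentalMatrix (fun x => A x l) (V l))
  (hsymm : HasGeneralizedHamiltonianSymmetry A) (htrace : ∀ (x : ℝ) (l : ℂ), (A x l).trace = 0)
include hV hsymm

include htrace in
/-- The symmetry (A2) forces the coefficients of the characteristic polynomials of `V(x, l)` and
`V(x, -l)` to be interchanged. -/
lemma HasGeneralizedHamiltonianSymmetry.trace_eq_trace_adjugate_neg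
    (hVc : ∀ x, Continuous fun l => V l x) (l : ℂ) (x : ℝ) :
    (V l x).trace = (V (-l) x).adjugate.trace := by
  obtain ⟨B, hfin, hB⟩ := hsymm.exists_skew
  -- The identity of traces is proved where `B l` is invertible; continuity in `l` extends it across
  -- the finitely many exceptional points, which may include the given one.
  have hdense : Dense {l : ℂ | (B l).det = 0}ᶜ := hfin.countable.dense_compl ℂ
  have hc1 : Continuous fun l => (V l x).trace := (hVc x).matrix_trace
  have hc2 : Continuous fun l => (V (-l) x).adjugate.trace :=
    ((hVc x).comp continuous_neg).matrix_adjugate.matrix_trace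
  refine congrFun (hc1.ext_on hdense hc2 fun l hl => ?_) l
  exact trace_eq_trace_adjugate_of_transpose_mul_mul_eq hl ((hV (-l)).det_eq_one (htrace · (-l)) x)
    ((hV l).transpose_mul_mul_eq (hV (-l)) (hB · l) x)

/-- The symmetry (A1) for the fundamental matrix. -/
lemma HasGeneralizedHamiltonianSymmetry.fundamentalMatrix_conj
    (hcont : Continuous (fun p : ℝ × ℂ => A p.1 p.2))
    (hentire : ∀ (x : ℝ) (i j : Fin 3), Differentiable ℂ (fun l : ℂ => A x l i j))
    (l : ℂ) : V (conj l) = fun x => (V l x).map conj := by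
  have h1 : ∀ x, A x (conj l) = (A x l).map conj := fun x => by
    ext i j
    exact apply_conj_of_im_eq_zero (hentire x i j) (fun t => hsymm.real_of_real x t i j) l
  have hc : Continuous fun x => A x (conj l) :=
    hcont.comp (f := fun x : ℝ => (x, conj l)) (by fun_prop)
  refine (hV (conj l)).unique hc ?_
  have := (hV l).map_conj
  simpa only [← h1] using this

include htrace in
lemma HasGeneralizedHamiltonianSymmetry.adjugate_trace_eq_conj_trace
    (hcont : Continuous (fun p : ℝ × ℂ => A p.1 p.2))
    (hentire : ∀ (x : ℝ) (i j : Fin 3), Differentiable ℂ (fun l : ℂ => A x l i j))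
    (hVc : ∀ x, Continuous fun l => V l x) {l : ℂ} (hl : l.re = 0) (x : ℝ) :
    (V l x).adjugate.trace = conj (V l x).trace := by
  have hneg : -l = conj l := by
    apply Complex.ext <;> simp [hl]
  have h := hsymm.trace_eq_trace_adjugate_neg hV htrace hVc (-l) x
  rw [neg_neg, hneg, hsymm.fundamentalMatrix_conj hV hcont hentire l] at h
  rw [← h]
  simp [Matrix.trace_fin_three]

end Monodromy

/-! ### Bloch solutions and the algebraic multiplicity -/

section Bloch

variable {n : ℕ} {a V : ℝ → Matrix (Fin n) (Fin n) ℂ} {T : ℝ}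

/-- By periodicity the translate of a solution is again a solution, hence determined by its value at
`0`. -/
lemma IsPrincipalFundamentalMatrix.apply_add_period (ha : Continuous a)
    (hper : ∀ x, a (x + T) = a x) (hV : IsPrincipalFundamentalMatrix a V) (w : Fin n → ℂ) (x : ℝ) :
    (V (x + T)).mulVec w = (V x).mulVec ((V T).mulVec w) := by
  have hmem : (fun x => (V (x + T)).mulVec w) ∈ solutionSpace a := by
    rw [mem_solutionSpace_iff]
    intro x
    have := (mem_solutionSpace_iff.mp (hV.mulVec_mem w) (x + T)).comp_add_const x T
    rwa [hper] at this
  have := congrFun (hV.eq_mulVec ha hmem) x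
  simpa using this

/-- The Bloch solution through an eigenvector of the monodromy matrix. -/
lemma IsPrincipalFundamentalMatrix.bloch_apply_add (ha : Continuous a)
    (hper : ∀ x, a (x + T) = a x) (hV : IsPrincipalFundamentalMatrix a V) {w : Fin n → ℂ} {μ : ℂ}
    (hw : (V T).mulVec w = μ • w) (x : ℝ) :
    (V (x + T)).mulVec w = μ • (V x).mulVec w := by
  rw [hV.apply_add_period ha hper, hw, Matrix.mulVec_smul]

lemma IsPrincipalFundamentalMatrix.bloch_mem (ha : Continuous a)
    (hper : ∀ x, a (x + T) = a x) (hV : IsPrincipalFundamentalMatrix a V) {w : Fin n → ℂ} {μ : ℂ}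
    (hw : (V T).mulVec w = μ • w) :
    (fun x => (V x).mulVec w) ∈ generalizedBlochSpace a T μ := by
  refine ⟨hV.mulVec_mem w, ?_⟩
  have h : (fun x => (V x).mulVec w) ∈ (translation n T).eigenspace μ := by
    rw [Module.End.mem_eigenspace_iff]
    ext1 x
    exact hV.bloch_apply_add ha hper hw x
  exact Module.End.genEigenspace_le_maximal (translation n T) μ 1 h

/-- Initial values parametrize the solutions. -/
noncomputable def IsPrincipalFundamentalMatrix.solutionEquiv (ha : Continuous a)
    (hV : IsPrincipalFundamentalMatrix a V) : (Fin n → ℂ) ≃ₗ[ℂ] solutionSpace a where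
  toFun w := ⟨fun x => (V x).mulVec w, hV.mulVec_mem w⟩
  invFun v := v.1 0
  map_add' v w := by ext1; ext1 x; exact Matrix.mulVec_add (V x) v w
  map_smul' c w := by ext1; ext1 x; exact Matrix.mulVec_smul (V x) c w
  left_inv w := by simp [hV.1]
  right_inv v := by ext1; exact (hV.eq_mulVec ha v.2).symm

lemma exists_eigenvector_of_mem_roots {M : Matrix (Fin n) (Fin n) ℂ} {μ : ℂ}
    (h : μ ∈ M.charpoly.roots) : ∃ w : Fin n → ℂ, w ≠ 0 ∧ M.mulVec w = μ • w := by
  have h0 := (Polynomial.mem_roots'.mp h).2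
  rw [Polynomial.IsRoot.def, Matrix.eval_charpoly] at h0
  obtain ⟨w, hw, h1⟩ := Matrix.exists_mulVec_eq_zero_iff.mpr h0
  refine ⟨w, hw, ?_⟩
  rw [Matrix.sub_mulVec, sub_eq_zero] at h1
  rw [← h1]
  simp [Matrix.scalar_apply, ← Matrix.smul_one_eq_diagonal, Matrix.smul_mulVec]

/-- If the monodromy matrix has `n` distinct eigenvalues on the unit circle, all solutions are
spanned by Bloch solutions. -/
lemma IsPrincipalFundamentalMatrix.finrank_iSup_bloch (ha : Continuous a)
    (hper : ∀ x, a (x + T) = a x) (hV : IsPrincipalFundamentalMatrix a V) {μ : Fin n → ℂ}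
    (hinj : Function.Injective μ) (hnorm : ∀ i, ‖μ i‖ = 1)
    (hroot : ∀ i, μ i ∈ (V T).charpoly.roots) :
    Module.finrank ℂ (⨆ μ ∈ {μ : ℂ | ‖μ‖ = 1}, generalizedBlochSpace a T μ :
      Submodule ℂ (ℝ → Fin n → ℂ)) = n := by
  choose w hw0 hw using fun i => exists_eigenvector_of_mem_roots (hroot i)
  have hli : LinearIndependent ℂ w :=
    Module.End.eigenvectors_linearIndependent' (Matrix.toLin' (V T)) μ hinj w fun i => by
      rw [Module.End.hasEigenvector_iff, Module.End.mem_eigenspace_iff]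
      exact ⟨by simpa using hw i, hw0 i⟩
  have hspan : Submodule.span ℂ (Set.range w) = ⊤ :=
    hli.span_eq_top_of_card_eq_finrank' (by simp)
  have hsup : (⨆ μ ∈ {μ : ℂ | ‖μ‖ = 1}, generalizedBlochSpace a T μ :
      Submodule ℂ (ℝ → Fin n → ℂ)) = solutionSpace a := by
    refine le_antisymm (iSup₂_le fun μ _ => inf_le_left) fun v hv => ?_
    have h0 : v 0 ∈ Submodule.span ℂ (Set.range w) := by rw [hspan]; trivial
    have key : ∀ u ∈ Submodule.span ℂ (Set.range w), (fun x => (V x).mulVec u) ∈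
        (⨆ μ ∈ {μ : ℂ | ‖μ‖ = 1}, generalizedBlochSpace a T μ :
          Submodule ℂ (ℝ → Fin n → ℂ)) := by
      intro u hu
      induction hu using Submodule.span_induction with
      | mem u hu =>
        obtain ⟨i, rfl⟩ := hu
        exact Submodule.mem_iSup_of_mem (μ i)
          (Submodule.mem_iSup_of_mem (hnorm i) (hV.bloch_mem ha hper (hw i)))
      | zero =>
        simp only [Matrix.mulVec_zero]
        exact Submodule.zero_mem _
      | add u u' _ _ hu hu' =>
        simp only [Matrix.mulVec_add]
        exact Submodule.add_mem _ hu hu'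
      | smul c u _ hu =>
        simp only [Matrix.mulVec_smul]
        exact Submodule.smul_mem _ c hu
    rw [hV.eq_mulVec ha hv]
    exact key _ h0
  rw [hsup, ← (hV.solutionEquiv ha).finrank_eq, Module.finrank_fin_fun]

end Bloch

/-! ### Fredholm operators and Weyl sequences -/

/-- A bounded approximate null sequence of a Fredholm operator has a convergent subsequence. -/
lemma ContinuousLinearMap.IsFredholm.exists_tendsto_subseq {E F : Type*} [NormedAddCommGroup E]
    [NormedSpace ℂ E] [NormedAddCommGroup F] [NormedSpace ℂ F] {L : E →L[ℂ] F} (hL : L.IsFredholm)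
    {x : ℕ → E} {C : ℝ} (hx : ∀ k, ‖x k‖ ≤ C)
    (hLx : Filter.Tendsto (fun k => L (x k)) Filter.atTop (nhds 0)) :
    ∃ (e : E) (φ : ℕ → ℕ), StrictMono φ ∧
      Filter.Tendsto (fun k => x (φ k)) Filter.atTop (nhds e) := by
  obtain ⟨v, hv, -⟩ := hL.exists_isQuasiInverse
  rw [LinearMap.IsLeftQuasiInverse, LinearMap.FiniteRangeSetoid.equiv_iff_hasNoetherianRange] at hv
  -- With `v` inverting `L` up to finite rank, `x k = v (L (x k)) - D (x k)`: the first term tends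
  -- to zero and the second is bounded in a finite-dimensional space.
  set D : E →ₗ[ℂ] E := (v : F →ₗ[ℂ] E) ∘ₗ (L : E →ₗ[ℂ] F) - LinearMap.id with hD
  have hfin : FiniteDimensional ℂ D.range := Module.Finite.of_fg hv.hasFiniteRange.fg_range
  have : ProperSpace D.range := FiniteDimensional.proper ℂ D.range
  have hDx : ∀ k, D (x k) = v (L (x k)) - x k := fun k => rfl
  have hvL : Filter.Tendsto (fun k => v (L (x k))) Filter.atTop (nhds 0) := by
    have h := (v.continuous.tendsto 0).comp hLx
    rwa [map_zero] at h
  obtain ⟨C', hC'⟩ := (Metric.isBounded_range_of_tendsto _ hvL).exists_norm_le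
  have hbd : ∀ k, (⟨D (x k), LinearMap.mem_range_self D (x k)⟩ : D.range) ∈
      Metric.closedBall 0 (C' + C) := by
    intro k
    rw [mem_closedBall_zero_iff]
    change ‖v (L (x k)) - x k‖ ≤ C' + C
    exact (norm_sub_le _ _).trans (add_le_add (hC' _ ⟨k, rfl⟩) (hx k))
  obtain ⟨y, -, φ, hφ, hlim⟩ := tendsto_subseq_of_bounded Metric.isBounded_closedBall hbd
  refine ⟨0 - y, φ, hφ, ?_⟩
  have h1 := (hvL.comp hφ.tendsto_atTop).sub ((continuous_subtype_val.tendsto y).comp hlim)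
  refine h1.congr fun k => ?_
  simp [hDx]

/-! ### Elements of the Sobolev space -/

section Sobolev

variable {n : ℕ}

/-- A compactly supported function of class `C¹` together with its derivative is in `H¹`. -/
lemma toLp_mem_H1Space {u w : ℝ → EuclideanSpace ℂ (Fin n)} (hd : ∀ x, HasDerivAt u (w x) x)
    (hwc : Continuous w) (hu : HasCompactSupport u) (hw : HasCompactSupport w)
    (hu2 : MemLp u 2 (volume : Measure ℝ)) (hw2 : MemLp w 2 (volume : Measure ℝ)) :
    (hu2.toLp u, hw2.toLp w) ∈ H1Space n := by
  have huc : Continuous u := continuous_iff_continuousAt.mpr fun x => (hd x).continuousAt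
  rw [H1Space, LinearMap.mem_ker]
  ext g
  have h1 : ∫ x, -(deriv g x • (hu2.toLp u) x) = ∫ x, -(deriv g x • u x) :=
    integral_congr_ae (by filter_upwards [hu2.coeFn_toLp] with x hx; rw [hx])
  have h2 : ∫ x, g x • (hw2.toLp w) x = ∫ x, g x • w x :=
    integral_congr_ae (by filter_upwards [hw2.coeFn_toLp] with x hx; rw [hx])
  have hdg : Continuous (deriv g) := (SchwartzMap.derivCLM ℂ ℂ g).continuous
  -- Integration by parts against a Schwartz function; compact support makes the products
  -- integrable.
  have h3 : ∫ x, g x • w x = -∫ x, deriv g x • u x :=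
    integral_bilinear_hasDerivAt_right_eq_neg_left_of_integrable
      (L := ContinuousLinearMap.lsmul ℝ ℂ) (fun x _ => g.hasDerivAt x) (fun x _ => hd x)
      ((g.continuous.smul hwc).integrable_of_hasCompactSupport hw.smul_left)
      ((hdg.smul huc).integrable_of_hasCompactSupport hu.smul_left)
      ((g.continuous.smul huc).integrable_of_hasCompactSupport hu.smul_left)
  simp [TemperedDistribution.derivCLM_apply_apply, h1, h2, h3, integral_neg]

/-- A cut-off function that equals one on `[-1, 1]` and vanishes outside `[-2, 2]`. -/
lemma exists_cutoff : ∃ (φ φ' : ℝ → ℝ) (C : ℝ), (∀ x, HasDerivAt φ (φ' x) x) ∧ Continuous φ' ∧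
    (∀ x, |x| ≤ 1 → φ x = 1) ∧ (∀ x, 2 < |x| → φ x = 0) ∧ (∀ x, 2 < |x| → φ' x = 0) ∧
    ∀ x, |φ' x| ≤ C := by
  let φ : ContDiffBump (0 : ℝ) := ⟨1, 2, one_pos, one_lt_two⟩
  have hc : Continuous (deriv φ) := φ.contDiff.continuous_deriv le_rfl
  obtain ⟨C, hC⟩ := hc.bounded_above_of_compact_support φ.hasCompactSupport.deriv
  refine ⟨φ, deriv φ, C, fun x => ?_, hc, fun x hx => ?_, fun x hx => ?_, fun x hx => ?_, hC⟩
  · exact ((φ.contDiff (n := 1)).differentiable one_ne_zero x).hasDerivAt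
  · exact φ.one_of_mem_closedBall (by simpa using hx)
  · exact φ.zero_of_le_dist (by simpa using hx.le)
  · by_contra h
    have := support_deriv_subset (f := φ) h
    rw [φ.tsupport_eq, mem_closedBall_zero_iff, Real.norm_eq_abs] at this
    exact absurd this (not_le.mpr hx)

variable {a : ℝ → Matrix (Fin n) (Fin n) ℂ}

lemma continuous_toEuclideanCLM :
    Continuous (Matrix.toEuclideanCLM (n := Fin n) (𝕜 := ℂ)) := by
  refine continuous_clm_apply.mpr fun v => ?_
  refine (PiLp.continuous_toLp 2 fun _ : Fin n => ℂ).comp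
    (f := fun A : Matrix (Fin n) (Fin n) ℂ => A.mulVec v.ofLp) ?_
  fun_prop

lemma memLp_top_toEuclideanCLM (ha : Continuous a) {K : ℝ}
    (hK : ∀ x, ‖Matrix.toEuclideanCLM (n := Fin n) (𝕜 := ℂ) (a x)‖ ≤ K) :
    MemLp (fun x => Matrix.toEuclideanCLM (n := Fin n) (𝕜 := ℂ) (a x)) ∞
      (volume : Measure ℝ) := by
  exact memLp_top_of_bound (continuous_toEuclideanCLM.comp ha).aestronglyMeasurable K (Filter.Eventually.of_forall hK)

/-- Cutting off a bounded solution that is bounded away from zero to an interval of length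
comparable to `R` yields approximate null vectors of `d/dx - a`. -/
lemma exists_approximate_null_vector (ha : Continuous a) {K : ℝ}
    (hK : ∀ x, ‖Matrix.toEuclideanCLM (n := Fin n) (𝕜 := ℂ) (a x)‖ ≤ K)
    {v : ℝ → EuclideanSpace ℂ (Fin n)}
    (hv : ∀ x, HasDerivAt v (Matrix.toEuclideanCLM (n := Fin n) (𝕜 := ℂ) (a x) (v x)) x)
    {m m' : ℝ} (hm : 0 < m) (hmv : ∀ x, m ≤ ‖v x‖) (hvm : ∀ x, ‖v x‖ ≤ m') :
    ∃ D : ℝ, ∀ R : ℝ, 0 < R → ∀ c : ℝ, ∃ y : H1Space n, ‖y.1.1‖ = 1 ∧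
      ‖firstOrderOperator a y‖ ≤ D / R ∧ ∀ᵐ x, 2 * R < |x - c| → y.1.1 x = 0 := by
  have hmem := memLp_top_toEuclideanCLM ha hK
  have hac : Continuous (fun x => Matrix.toEuclideanCLM (n := Fin n) (𝕜 := ℂ) (a x)) :=
    continuous_toEuclideanCLM.comp ha
  have hvc : Continuous v := continuous_iff_continuousAt.mpr fun x => (hv x).continuousAt
  obtain ⟨φ, φ', C, hφ, hφ'c, hone, hzero, hzero', hC⟩ := exists_cutoff
  have hφc : Continuous φ := continuous_iff_continuousAt.mpr fun x => (hφ x).continuousAt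
  have hm' : 0 ≤ m' := (norm_nonneg _).trans (hvm 0)
  have hC0 : 0 ≤ C := (abs_nonneg _).trans (hC 0)
  -- The norm of `u` is at least `m √(2R)`, that of the error `z` at most `(C m' / R) √(4R)`; the
  -- ratio is at most `D / R` after bounding `√2` by `2`.
  refine ⟨2 * C * m' / m, fun R hR c => ?_⟩
  let u : ℝ → EuclideanSpace ℂ (Fin n) := fun x => φ ((x - c) / R) • v x
  -- As `v` solves the equation, only the derivative of the cut-off survives in `w - a u = z`.
  let z : ℝ → EuclideanSpace ℂ (Fin n) := fun x => (φ' ((x - c) / R) * (1 / R)) • v x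
  let w : ℝ → EuclideanSpace ℂ (Fin n) := fun x =>
    φ ((x - c) / R) • Matrix.toEuclideanCLM (n := Fin n) (𝕜 := ℂ) (a x) (v x) + z x
  have hfar : ∀ x, x ∉ Metric.closedBall c (2 * R) → 2 < |(x - c) / R| := by
    intro x hx
    rw [Metric.mem_closedBall, Real.dist_eq, not_le] at hx
    rwa [abs_div, abs_of_pos hR, lt_div_iff₀ hR]
  have hu0 : ∀ x, x ∉ Metric.closedBall c (2 * R) → u x = 0 := fun x hx => by
    simp [u, hzero _ (hfar x hx)]
  have hz0 : ∀ x, x ∉ Metric.closedBall c (2 * R) → z x = 0 := fun x hx => by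
    simp [z, hzero' _ (hfar x hx)]
  have hw0 : ∀ x, x ∉ Metric.closedBall c (2 * R) → w x = 0 := fun x hx => by
    simp [w, hz0 x hx, hzero _ (hfar x hx)]
  have hus := HasCompactSupport.intro (isCompact_closedBall c (2 * R)) hu0
  have hzs := HasCompactSupport.intro (isCompact_closedBall c (2 * R)) hz0
  have hws := HasCompactSupport.intro (isCompact_closedBall c (2 * R)) hw0
  have hφa : Continuous fun x => φ ((x - c) / R) := by fun_prop
  have huc : Continuous u := hφa.smul hvc
  have hzc : Continuous z := by
    have h : Continuous fun x => φ' ((x - c) / R) * (1 / R) := by fun_prop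
    exact h.smul hvc
  have hwc : Continuous w := (hφa.smul (hac.clm_apply hvc)).add hzc
  have hu2 : MemLp u 2 (volume : Measure ℝ) := huc.memLp_of_hasCompactSupport hus
  have hz2 : MemLp z 2 (volume : Measure ℝ) := hzc.memLp_of_hasCompactSupport hzs
  have hw2 : MemLp w 2 (volume : Measure ℝ) := hwc.memLp_of_hasCompactSupport hws
  have hd : ∀ x, HasDerivAt u (w x) x := by
    intro x
    have h1 : HasDerivAt (fun x => φ ((x - c) / R)) (φ' ((x - c) / R) * (1 / R)) x :=
      (hφ _).comp x (((hasDerivAt_id x).sub_const c).div_const R)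
    exact h1.smul (hv x)
  let Y : H1Space n := ⟨(hu2.toLp u, hw2.toLp w), toLp_mem_H1Space hd hwc hus hws hu2 hw2⟩
  have hLY : firstOrderOperator a Y = hz2.toLp z := by
    have h1 : firstOrderOperator a Y = hw2.toLp w - matrixMulL2 a (hu2.toLp u) := rfl
    rw [h1]
    apply Lp.ext
    filter_upwards [Lp.coeFn_sub (hw2.toLp w) (matrixMulL2 a (hu2.toLp u)), hw2.coeFn_toLp,
      hu2.coeFn_toLp, hz2.coeFn_toLp, coeFn_matrixMulL2 hmem (hu2.toLp u)] with x h1 h2 h3 h4 h5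
    rw [h1, Pi.sub_apply, h2, h4, h5, h3]
    simp [w, u]
  have hvol : ∀ r : ℝ, 0 < r → (volume : Measure ℝ).real (Metric.closedBall c r) = 2 * r := by
    intro r hr
    rw [Measure.real, Real.volume_closedBall, ENNReal.toReal_ofReal (by positivity)]
  have hfinite : ∀ r : ℝ, (volume : Measure ℝ) (Metric.closedBall c r) ≠ ∞ := fun r =>
    measure_closedBall_lt_top.ne
  have hlow : m * (2 * R) ^ (1 / 2 : ℝ) ≤ ‖hu2.toLp u‖ := by
    have h1 : ‖indicatorConstLp 2 Metric.isClosed_closedBall.measurableSet (hfinite R) m‖ ≤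
        ‖hu2.toLp u‖ := by
      apply Lp.norm_le_norm_of_ae_le
      filter_upwards [indicatorConstLp_coeFn (p := 2)
        (hs := (Metric.isClosed_closedBall (x := c) (ε := R)).measurableSet)
        (hμs := hfinite R) (c := m), hu2.coeFn_toLp] with x h1 h2
      rw [h1, h2]
      by_cases hx : x ∈ Metric.closedBall c R
      · rw [Set.indicator_of_mem hx, Real.norm_of_nonneg hm.le]
        have : φ ((x - c) / R) = 1 := by
          apply hone
          rwa [abs_div, abs_of_pos hR, div_le_one hR, ← Real.dist_eq]
        simp only [u, this, one_smul]
        exact hmv x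
      · rw [Set.indicator_of_notMem hx, norm_zero]
        exact norm_nonneg _
    rw [norm_indicatorConstLp (by norm_num) (by norm_num), hvol R hR,
      Real.norm_of_nonneg hm.le] at h1
    simpa using h1
  have hupp : ‖hz2.toLp z‖ ≤ C * m' / R * (2 * (2 * R)) ^ (1 / 2 : ℝ) := by
    have hnn : 0 ≤ C * m' / R := by positivity
    have h1 : ‖hz2.toLp z‖ ≤ ‖indicatorConstLp 2 Metric.isClosed_closedBall.measurableSet
        (hfinite (2 * R)) (C * m' / R)‖ := by
      apply Lp.norm_le_norm_of_ae_le
      filter_upwards [indicatorConstLp_coeFn (p := 2)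
        (hs := (Metric.isClosed_closedBall (x := c) (ε := 2 * R)).measurableSet)
        (hμs := hfinite (2 * R)) (c := C * m' / R), hz2.coeFn_toLp] with x h1 h2
      rw [h1, h2]
      by_cases hx : x ∈ Metric.closedBall c (2 * R)
      · rw [Set.indicator_of_mem hx, Real.norm_of_nonneg hnn]
        simp only [z, norm_smul, norm_mul, Real.norm_eq_abs, abs_of_pos (one_div_pos.mpr hR)]
        calc |φ' ((x - c) / R)| * (1 / R) * ‖v x‖ ≤ C * (1 / R) * m' := by
              gcongr
              · exact hC _
              · exact hvm x
          _ = C * m' / R := by ring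
      · rw [Set.indicator_of_notMem hx, hz0 x hx, norm_zero, norm_zero]
    rw [norm_indicatorConstLp (by norm_num) (by norm_num), hvol (2 * R) (by positivity),
      Real.norm_of_nonneg hnn] at h1
    simpa using h1
  have hs0 : 0 < (2 * R) ^ (1 / 2 : ℝ) := by positivity
  have hpos : 0 < ‖hu2.toLp u‖ := (mul_pos hm hs0).trans_le hlow
  have hratio : ‖hz2.toLp z‖ ≤ 2 * C * m' / m / R * ‖hu2.toLp u‖ := by
    have h2 : (2 : ℝ) ^ (1 / 2 : ℝ) ≤ 2 := by
      calc (2 : ℝ) ^ (1 / 2 : ℝ) ≤ 2 ^ (1 : ℝ) :=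
            Real.rpow_le_rpow_of_exponent_le one_le_two (by norm_num)
        _ = 2 := Real.rpow_one 2
    calc ‖hz2.toLp z‖ ≤ C * m' / R * (2 * (2 * R)) ^ (1 / 2 : ℝ) := hupp
      _ = C * m' / R * (2 ^ (1 / 2 : ℝ) * (2 * R) ^ (1 / 2 : ℝ)) := by
          rw [Real.mul_rpow (by norm_num) (by positivity)]
      _ ≤ C * m' / R * (2 * (2 * R) ^ (1 / 2 : ℝ)) := by gcongr
      _ = 2 * C * m' / m / R * (m * (2 * R) ^ (1 / 2 : ℝ)) := by field_simp
      _ ≤ 2 * C * m' / m / R * ‖hu2.toLp u‖ := by gcongr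
  refine ⟨((‖hu2.toLp u‖⁻¹ : ℝ) : ℂ) • Y, ?_, ?_, ?_⟩
  · change ‖((‖hu2.toLp u‖⁻¹ : ℝ) : ℂ) • hu2.toLp u‖ = 1
    rw [norm_smul, Complex.norm_real, norm_inv, norm_norm, inv_mul_cancel₀ hpos.ne']
  · rw [map_smul, hLY, norm_smul, Complex.norm_real, norm_inv, norm_norm, inv_mul_le_iff₀ hpos]
    linarith [hratio]
  · change ∀ᵐ x, 2 * R < |x - c| → (((‖hu2.toLp u‖⁻¹ : ℝ) : ℂ) • hu2.toLp u) x = 0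
    filter_upwards [Lp.coeFn_smul ((‖hu2.toLp u‖⁻¹ : ℝ) : ℂ) (hu2.toLp u), hu2.coeFn_toLp]
      with x h1 h2 hx
    rw [h1, Pi.smul_apply, h2, hu0 x, smul_zero]
    rwa [Metric.mem_closedBall, Real.dist_eq, not_le]

/-- A first-order operator with a bounded solution that is bounded away from zero is not
Fredholm. -/
lemma not_isFredholm_firstOrderOperator (ha : Continuous a) {K : ℝ}
    (hK : ∀ x, ‖Matrix.toEuclideanCLM (n := Fin n) (𝕜 := ℂ) (a x)‖ ≤ K)
    {v : ℝ → EuclideanSpace ℂ (Fin n)}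
    (hv : ∀ x, HasDerivAt v (Matrix.toEuclideanCLM (n := Fin n) (𝕜 := ℂ) (a x) (v x)) x)
    {m m' : ℝ} (hm : 0 < m) (hmv : ∀ x, m ≤ ‖v x‖) (hvm : ∀ x, ‖v x‖ ≤ m') :
    ¬ (firstOrderOperator a).IsFredholm := by
  intro hF
  obtain ⟨D, hD⟩ := exists_approximate_null_vector ha hK hv hm hmv hvm
  -- The supports lie in `[2 * 8 ^ k, 6 * 8 ^ k]`; these are pairwise disjoint because `6 * 8 ^ k <
  -- 2 * 8 ^ (k + 1)`.
  choose y hy1 hy2 hy3 using fun k : ℕ => hD (8 ^ k) (by positivity) (4 * 8 ^ k)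
  have hlim : Filter.Tendsto (fun k => firstOrderOperator a (y k)) Filter.atTop (nhds 0) := by
    refine squeeze_zero_norm hy2 ?_
    exact tendsto_const_nhds.div_atTop (tendsto_pow_atTop_atTop_of_one_lt (by norm_num))
  have hbd : ∀ k, ‖y k‖ ≤ 1 + |D| + ‖matrixMulL2 a‖ := by
    intro k
    have h1 : (y k).1.2 = firstOrderOperator a (y k) + matrixMulL2 a (y k).1.1 := by
      change (y k).1.2 = ((y k).1.2 - matrixMulL2 a (y k).1.1) + matrixMulL2 a (y k).1.1
      rw [sub_add_cancel]
    have h2 : ‖firstOrderOperator a (y k)‖ ≤ |D| := by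
      refine (hy2 k).trans ?_
      rw [div_le_iff₀ (by positivity)]
      have : (1 : ℝ) ≤ 8 ^ k := one_le_pow₀ (by norm_num)
      nlinarith [le_abs_self D, abs_nonneg D]
    have h3 : ‖matrixMulL2 a (y k).1.1‖ ≤ ‖matrixMulL2 a‖ := by
      have := (matrixMulL2 a).le_opNorm (y k).1.1
      rwa [hy1, mul_one] at this
    rw [Submodule.coe_norm, Prod.norm_def]
    refine max_le ?_ ?_
    · rw [hy1]
      linarith [abs_nonneg D, norm_nonneg (matrixMulL2 a)]
    · rw [h1]
      linarith [norm_add_le (firstOrderOperator a (y k)) (matrixMulL2 a (y k).1.1)]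
  obtain ⟨e, φ, hφ, hconv⟩ := hF.exists_tendsto_subseq hbd hlim
  have hconv1 : Filter.Tendsto (fun k => (y (φ k)).1.1) Filter.atTop (nhds e.1.1) :=
    ((continuous_fst.comp continuous_subtype_val).tendsto e).comp hconv
  have horth : ∀ j k, j < k → inner ℂ (y j).1.1 (y k).1.1 = 0 := by
    intro j k hjk
    rw [L2.inner_def]
    have h0 : (fun x => inner ℂ ((y j).1.1 x) ((y k).1.1 x)) =ᵐ[volume] fun _ => 0 := by
      filter_upwards [hy3 j, hy3 k] with x h1 h2
      have h8 : (8 : ℝ) ^ k ≥ 8 * 8 ^ j := by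
        rw [← pow_succ']
        exact pow_le_pow_right₀ (by norm_num) hjk
      have hj : (0 : ℝ) < 8 ^ j := by positivity
      rcases le_or_gt |x - 4 * 8 ^ j| (2 * 8 ^ j) with h | h
      · have h2' : (2 : ℝ) * 8 ^ k < |x - 4 * 8 ^ k| := by
          rw [abs_le] at h
          rw [lt_abs]
          right
          linarith [h.2]
        rw [h2 h2', inner_zero_right]
      · rw [h1 h, inner_zero_left]
    rw [integral_congr_ae h0, integral_zero]
  -- Orthonormal vectors are at distance `√2`, so no subsequence is Cauchy.
  have hdist : ∀ j k, j < k → 1 ≤ dist (y j).1.1 (y k).1.1 := by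
    intro j k hjk
    have h1 := norm_sub_sq (𝕜 := ℂ) (y j).1.1 (y k).1.1
    rw [horth j k hjk, hy1, hy1] at h1
    rw [dist_eq_norm]
    simp at h1
    nlinarith [norm_nonneg ((y j).1.1 - (y k).1.1)]
  obtain ⟨N, hN⟩ := Metric.cauchySeq_iff.mp hconv1.cauchySeq 1 one_pos
  exact absurd (hN N le_rfl (N + 1) (Nat.le_succ N))
    (not_lt.mpr (hdist _ _ (hφ (Nat.lt_succ_self N))))

end Sobolev

/-! ### Floquet multipliers and the essential spectrum; the main theorem -/

/-- A Floquet multiplier on the unit circle makes the operator `d/dx - a` non-Fredholm. -/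
lemma not_isFredholm_of_bloch {n : ℕ} {a V : ℝ → Matrix (Fin n) (Fin n) ℂ} {T : ℝ} (hT : 0 < T)
    (ha : Continuous a) (hper : ∀ x, a (x + T) = a x) (hV : IsPrincipalFundamentalMatrix a V)
    (hdet : ∀ x, (V x).det ≠ 0) {μ : ℂ} (hμ : ‖μ‖ = 1) (hroot : μ ∈ (V T).charpoly.roots) :
    ¬ (firstOrderOperator a).IsFredholm := by
  obtain ⟨w, hw0, hw⟩ := exists_eigenvector_of_mem_roots hroot
  let v : ℝ → EuclideanSpace ℂ (Fin n) := fun x => WithLp.toLp 2 ((V x).mulVec w)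
  have hv : ∀ x, HasDerivAt v (Matrix.toEuclideanCLM (n := Fin n) (𝕜 := ℂ) (a x) (v x)) x := by
    intro x
    have h := mem_solutionSpace_iff.mp (hV.mulVec_mem w) x
    exact ((PiLp.continuousLinearEquiv 2 ℝ fun _ : Fin n => ℂ).symm.hasFDerivAt.comp_hasDerivAt x h)
  have hvc : Continuous v := continuous_iff_continuousAt.mpr fun x => (hv x).continuousAt
  have hv0 : ∀ x, v x ≠ 0 := by
    intro x hx
    refine hw0 (Matrix.eq_zero_of_mulVec_eq_zero (hdet x) ?_)
    simpa [v] using hx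
  -- As `‖μ‖ = 1`, the norm of the Bloch solution is periodic; being continuous and nowhere zero, it
  -- attains a positive minimum and a finite maximum.
  have hvper : Function.Periodic (fun x => ‖v x‖) T := by
    intro x
    have h : v (x + T) = μ • v x := by
      simp only [v, hV.bloch_apply_add ha hper hw x, WithLp.toLp_smul]
    simp only [h, norm_smul, hμ, one_mul]
  have hcomp := hvper.compact_of_continuous hT.ne' hvc.norm
  obtain ⟨-, ⟨x₀, rfl⟩, hmin⟩ := hcomp.exists_isLeast (Set.range_nonempty _)
  obtain ⟨-, ⟨x₁, rfl⟩, hmax⟩ := hcomp.exists_isGreatest (Set.range_nonempty _)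
  have haper : Function.Periodic
      (fun x => Matrix.toEuclideanCLM (n := Fin n) (𝕜 := ℂ) (a x)) T := fun x => by
    simp only [hper]
  obtain ⟨K, hK⟩ := (haper.isBounded_of_continuous hT.ne'
    (continuous_toEuclideanCLM.comp ha)).exists_norm_le
  exact not_isFredholm_firstOrderOperator ha (fun x => hK _ ⟨x, rfl⟩) hv
    (norm_pos_iff.mpr (hv0 x₀)) (fun x => hmin ⟨x, rfl⟩) (fun x => hmax ⟨x, rfl⟩)

theorem theorem1p2
    (A : ℝ → ℂ → Matrix (Fin 3) (Fin 3) ℂ) (T : ℝ) (hT : 0 < T)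
    (hcont : Continuous (fun p : ℝ × ℂ => A p.1 p.2))
    (hentire : ∀ (x : ℝ) (i j : Fin 3), Differentiable ℂ (fun l : ℂ => A x l i j))
    (hper : ∀ (x : ℝ) (l : ℂ), A (x + T) l = A x l)
    (hsymm : HasGeneralizedHamiltonianSymmetry A)
    (htrace : ∀ (x : ℝ) (l : ℂ), (A x l).trace = 0)
    (l : ℂ) (hl : l.re = 0)
    (M : Matrix (Fin 3) (Fin 3) ℂ) (hM : M = monodromyMatrix (fun x => A x l) T)
    (f : ℂ) (hf : f = M.trace) :
    -- one or three eigenvalues on the unit circle, with algebraic multiplicity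
    (unitCircleEigenvalueCount M = 1 ∨ unitCircleEigenvalueCount M = 3) ∧
    -- the complex form of the discriminant
    ((delta3 f : ℂ) =
      (‖f‖ : ℂ) ^ 4 - 4 * f ^ 3 - 4 * (conj f) ^ 3 + 18 * (‖f‖ : ℂ) ^ 2 - 27) ∧
    -- classification by the sign of the discriminant
    (ThreeDistinctOnCircle M ↔ delta3 f < 0) ∧
    (delta3 f < 0 → l ∈ essentialSpectrumL2 A ∧ essentialSpectrumMultiplicity A T l = 3) ∧
    (OneOnCircleTwoReflected M ↔ 0 < delta3 f) ∧
    (DegenerateOnCircle M ↔ delta3 f = 0) ∧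
    -- classification by the position relative to the deltoid
    (ThreeDistinctOnCircle M ↔ f ∈ deltoidInside) ∧
    (OneOnCircleTwoReflected M ↔ f ∈ deltoidOutside) ∧
    (DegenerateOnCircle M ↔ f ∈ deltoid) ∧
    -- on the deltoid, away from the cusps and at the cusps
    (f ∈ deltoid → f ≠ 3 → f ≠ 3 * Complex.exp (2 * Real.pi * Complex.I / 3) →
      f ≠ 3 * Complex.exp (4 * Real.pi * Complex.I / 3) →
      ∃ μ ν : ℂ, μ ≠ ν ∧ ‖μ‖ = 1 ∧ ‖ν‖ = 1 ∧ M.charpoly.roots = {μ, μ, ν}) ∧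
    (f = 3 → M.charpoly.roots = {1, 1, 1}) ∧
    (f = 3 * Complex.exp (2 * Real.pi * Complex.I / 3) →
      M.charpoly.roots = {Complex.exp (2 * Real.pi * Complex.I / 3),
        Complex.exp (2 * Real.pi * Complex.I / 3), Complex.exp (2 * Real.pi * Complex.I / 3)}) ∧
    (f = 3 * Complex.exp (4 * Real.pi * Complex.I / 3) →
      M.charpoly.roots = {Complex.exp (4 * Real.pi * Complex.I / 3),
        Complex.exp (4 * Real.pi * Complex.I / 3), Complex.exp (4 * Real.pi * Complex.I / 3)}) := by

  obtain ⟨V, hV, hVc⟩ := exists_isPrincipalFundamentalMatrix hcont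
  have hac : Continuous fun x => A x l :=
    hcont.comp (f := fun x : ℝ => (x, l)) (by fun_prop)
  have hMV : M = V l T := hM.trans ((hV l).monodromyMatrix_eq hac T)
  have hdet : ∀ x, (V l x).det = 1 := (hV l).det_eq_one (htrace · l)
  have hdetM : M.det = 1 := by rw [hMV, hdet]
  have hadj : M.adjugate.trace = conj M.trace := by
    rw [hMV]
    exact hsymm.adjugate_trace_eq_conj_trace hV htrace hcont hentire hVc hl T
  subst hf
  refine ⟨unitCircleEigenvalueCount_eq_one_or_three hdetM hadj, ?_,
    threeDistinctOnCircle_iff hdetM hadj, fun hneg => ?_, oneOnCircleTwoReflected_iff hdetM hadj,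
    degenerateOnCircle_iff hdetM hadj, ?_, ?_, ?_, fun hf h0 h1 h2 => ?_, fun h => ?_, fun h => ?_,
    fun h => ?_⟩
  · rw [IsSelfInversiveTriple.ofReal_delta3, Complex.mul_conj, Complex.normSq_eq_norm_sq]
    push_cast
    ring
  · obtain ⟨μ₁, μ₂, μ₃, hr, h12, h13, h23, h1, h2, h3⟩ :=
      (threeDistinctOnCircle_iff hdetM hadj).mpr hneg
    rw [hMV] at hr
    constructor
    · exact not_isFredholm_of_bloch hT hac (hper · l) (hV l)
        (fun x => by rw [hdet]; exact one_ne_zero) h1 (by rw [hr]; simp)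
    · refine (hV l).finrank_iSup_bloch hac (hper · l) (μ := ![μ₁, μ₂, μ₃]) ?_ ?_ ?_
      · intro i j hij
        fin_cases i <;> fin_cases j <;> simp_all
      · intro i
        fin_cases i <;> assumption
      · intro i
        rw [hr]
        fin_cases i <;> simp
  · rw [mem_deltoidInside_iff, threeDistinctOnCircle_iff hdetM hadj]
  · rw [mem_deltoidOutside_iff, oneOnCircleTwoReflected_iff hdetM hadj]
  · rw [mem_deltoid_iff, degenerateOnCircle_iff hdetM hadj]
  · refine exists_charpoly_roots_double hdetM hadj ((mem_deltoid_iff _).mp hf) fun ω hω heq => ?_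
    rcases eq_of_pow_three_eq_one hω with rfl | rfl | rfl
    · exact h0 (by rw [heq, mul_one])
    · exact h1 heq
    · exact h2 heq
  · exact charpoly_roots_of_trace_eq_three_mul hdetM hadj (one_pow 3) (by rw [h, mul_one])
  · exact charpoly_roots_of_trace_eq_three_mul hdetM hadj exp_two_pi_div_three_pow h
  · refine charpoly_roots_of_trace_eq_three_mul hdetM hadj ?_ h
    rw [exp_four_pi_div_three_eq, pow_right_comm, exp_two_pi_div_three_pow, one_pow]
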